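/- Corollary 4.1. Let $n \ge 1$, and let $\widetilde{S}_n$ be the affine symmetric group, i.e. the group of bijections $w : \mathbb{Z} \to \mathbb{Z}$ with $w(x+n) = w(x)+n$ for all $x$ and $\sum_{i=1}^n w(i) = \binom{n+1}{2}$. It is generated by $s_i$, $i \in \mathbb{Z}/n\mathbb{Z}$, where, for $n \ge 2$, $s_i$ interchanges $i+kn$ and $i+1+kn$ for every $k \in \mathbb{Z}$ (for $n=1$ the group is trivial). Let $\ell(w)$ be the least number of factors in an expression of $w$ as a product of generators; an expression with $\ell(w)$ factors is called reduced. An element $w$ is fully commutative if any reduced expression for $w$ can be obtained from any other by repeatedly interchanging adjacent factors $s_i s_j \mapsto s_j s_i$ with $i - j \not\equiv 0, \pm 1 \pmod n$. Let $\widetilde{S}_n^{FC}$ be the set of fully commutative elements of $\widetilde{S}_n$. There are only finitely many fully commutative elements of each length, and the coefficients $a_i$ of $$f_n(q) = \sum_{w \in \widetilde{S}_n^{FC}} q^{\ell(w)} = \sum_{i \ge 0} a_i q^i$$ are eventually periodic, with (least) period $m$ dividing $n$: the least positive integer $m$ such that $a_{i+m} = a_i$ for all sufficiently large $i$ exists and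 divides $n$. When $n = p$ is prime, this period is $m = 1$, and for all sufficiently large $i$ the number of fully commutative elements of length $i$ in $\widetilde{S}_p$ is precisely $$\frac{1}{p}\left(\binom{2p}{p} - 2\right).$$ -/

import Mathlib

namespace AffineSymmetric

/-- A bijection `w : ℤ → ℤ` with `w (x + n) = w x + n` satisfies this for all multiples of `n`. -/
theorem map_add_mul {n : ℕ} {w : Equiv.Perm ℤ} (hw : ∀ x, w (x + n) = w x + n) (x k : ℤ) :
    w (x + k * n) = w x + k * n := by
  induction k using Int.induction_on with
  | zero => simp
  | succ k ih =>
    rw [show x + ((k : ℤ) + 1) * n = (x + k * n) + n by ring, hw, ih]; ring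
  | pred k ih =>
    have h := hw (x + (-(k : ℤ) - 1) * n)
    rw [show x + (-(k : ℤ) - 1) * n + n = x + -(k : ℤ) * n by ring, ih] at h
    linarith

theorem inv_map_add {n : ℕ} {w : Equiv.Perm ℤ} (hw : ∀ x, w (x + n) = w x + n) (x : ℤ) :
    w⁻¹ (x + n) = w⁻¹ x + n := by
  apply w.injective
  rw [hw]; simp

/-- The sum over one window of an `n`-periodic function is unchanged by reindexing along a
bijection `v` of `ℤ` that commutes with the shift by `n`. -/
theorem sum_comp_eq {n : ℕ} {v : Equiv.Perm ℤ} (hv : ∀ x, v (x + n) = v x + n)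
    (f : ℤ → ℤ) (hf : ∀ x, f (x + n) = f x) :
    ∑ i ∈ Finset.Icc (1 : ℤ) n, f (v i) = ∑ i ∈ Finset.Icc (1 : ℤ) n, f i := by
  rcases Nat.eq_zero_or_pos n with rfl | hn
  · simp
  have hn' : (0 : ℤ) < n := by exact_mod_cast hn
  have hfk : ∀ x k : ℤ, f (x + k * n) = f x := fun x k => by
    induction k using Int.induction_on with
    | zero => simp
    | succ k ih =>
      rw [show x + ((k : ℤ) + 1) * n = (x + k * n) + n by ring, hf, ih]
    | pred k ih =>
      rw [← hf, show x + (-(k : ℤ) - 1) * n + n = x + -(k : ℤ) * n by ring, ih]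
  have rep : ∀ x : ℤ, (x - 1) % n + 1 = x + (-((x - 1) / n)) * n := fun x => by
    have := Int.emod_add_mul_ediv (x - 1) n
    linarith
  have mem : ∀ x : ℤ, (x - 1) % n + 1 ∈ Finset.Icc (1 : ℤ) n := fun x => by
    have h1 := Int.emod_nonneg (x - 1) hn'.ne'
    have h2 := Int.emod_lt_of_pos (x - 1) hn'
    rw [Finset.mem_Icc]; omega
  have uniq : ∀ x k : ℤ, x ∈ Finset.Icc (1 : ℤ) n → (x + k * n - 1) % n + 1 = x :=
    fun x k hx => by
      rw [Finset.mem_Icc] at hx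
      rw [show x + k * n - 1 = (x - 1) + k * n by ring, Int.add_mul_emod_self_right,
        Int.emod_eq_of_lt (by omega) (by omega)]
      ring
  refine Finset.sum_nbij' (fun i => (v i - 1) % n + 1) (fun j => (v⁻¹ j - 1) % n + 1)
    (fun i _ => mem _) (fun j _ => mem _) (fun i hi => ?_) (fun j hj => ?_) (fun i _ => ?_)
  · simp only [rep (v i), map_add_mul (inv_map_add hv), show v⁻¹ (v i) = i from v.symm_apply_apply i]
    exact uniq i _ hi
  · simp only [rep (v⁻¹ j), map_add_mul hv, show v (v⁻¹ j) = j from v.apply_symm_apply j]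
    exact uniq j _ hj
  · simp only [rep (v i), hfk]

/-- The affine symmetric group: the bijections `w : ℤ → ℤ` with `w (x + n) = w x + n` for all `x`
and `w 1 + ⋯ + w n = 1 + ⋯ + n`, under composition. -/
def affineSymmetricGroup (n : ℕ) : Subgroup (Equiv.Perm ℤ) where
  carrier := {w | (∀ x, w (x + n) = w x + n) ∧
    ∑ i ∈ Finset.Icc (1 : ℤ) n, w i = ∑ i ∈ Finset.Icc (1 : ℤ) n, i}
  one_mem' := by simp
  mul_mem' := by
    rintro w v ⟨hw, hw'⟩ ⟨hv, hv'⟩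
    refine ⟨fun x => by simp [hv, hw], ?_⟩
    have h := sum_comp_eq hv (fun x => w x - x) (fun x => by simp [hw])
    simp only [Finset.sum_sub_distrib, hw', hv', sub_self] at h
    simpa using sub_eq_zero.mp h
  inv_mem' := by
    rintro w ⟨hw, hw'⟩
    refine ⟨inv_map_add hw, ?_⟩
    have h := sum_comp_eq (inv_map_add hw) (fun x => w x - x) (fun x => by simp [hw])
    simp only [Finset.sum_sub_distrib, hw', sub_self] at h
    simpa using (sub_eq_zero.mp h).symm

/-- The map underlying the generator `s_i`: it adds `1` to the integers congruent to `i` mod `n`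
and subtracts `1` from those congruent to `i + 1`, so for `n ≥ 2` it interchanges `i + k n` with
`i + 1 + k n` for every `k`. For `n = 1` it is the identity. -/
def simpleFun (n : ℕ) (i : ZMod n) (x : ℤ) : ℤ :=
  x + (if (x : ZMod n) = i then 1 else 0) - (if (x : ZMod n) = i + 1 then 1 else 0)

theorem simpleFun_involutive (n : ℕ) (i : ZMod n) : Function.Involutive (simpleFun n i) := by
  intro x
  by_cases h : i + 1 = i
  · have h' : ∀ y, simpleFun n i y = y := fun y => by simp only [simpleFun, h]; ring
    rw [h', h']
  by_cases h1 : (x : ZMod n) = i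
  · have e : simpleFun n i x = x + 1 := by
      rw [simpleFun, if_pos h1, if_neg (fun h2 => h (h2.symm.trans h1))]; ring
    have c : ((x + 1 : ℤ) : ZMod n) = i + 1 := by rw [Int.cast_add, h1, Int.cast_one]
    rw [e, simpleFun, if_pos c, if_neg (fun h2 => h (c.symm.trans h2))]; ring
  by_cases h2 : (x : ZMod n) = i + 1
  · have e : simpleFun n i x = x - 1 := by
      rw [simpleFun, if_pos h2, if_neg h1]; ring
    have c : ((x - 1 : ℤ) : ZMod n) = i := by rw [Int.cast_sub, h2, Int.cast_one]; ring
    rw [e, simpleFun, if_pos c, if_neg (fun h3 => h (h3.symm.trans c))]; ring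
  · have e : simpleFun n i x = x := by rw [simpleFun, if_neg h1, if_neg h2]; ring
    rw [e, e]

/-- The generators `s_i` of the affine symmetric group, with index `i` taken mod `n`. -/
def simple (n : ℕ) (i : ZMod n) : affineSymmetricGroup n :=
  ⟨(simpleFun_involutive n i).toPerm, by
    refine ⟨fun x => ?_, ?_⟩
    · simp only [Function.Involutive.coe_toPerm, simpleFun]
      simp; ring
    · simp only [Function.Involutive.coe_toPerm, simpleFun, Finset.sum_sub_distrib,
        Finset.sum_add_distrib]
      have h := sum_comp_eq (n := n) (v := Equiv.addRight (1 : ℤ)) (fun x => by simp; ring)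
        (fun x => if (x : ZMod n) = i + 1 then 1 else 0) (fun x => by simp)
      simp only [Equiv.coe_addRight, Int.cast_add, Int.cast_one, add_left_inj] at h
      rw [h]; ring⟩

/-- The product `s_{i₁} ⋯ s_{i_k}` of an expression `i₁, …, i_k` in the generators. -/
def wordProd (n : ℕ) (l : List (ZMod n)) : affineSymmetricGroup n :=
  (l.map (simple n)).prod

/-- The Coxeter length: the least number of factors in an expression for `w`. -/
noncomputable def length {n : ℕ} (w : affineSymmetricGroup n) : ℕ :=
  sInf {k | ∃ l : List (ZMod n), wordProd n l = w ∧ l.length = k}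

/-- `l` is a reduced expression for `w`. -/
def IsReducedWord {n : ℕ} (w : affineSymmetricGroup n) (l : List (ZMod n)) : Prop :=
  wordProd n l = w ∧ l.length = length w

/-- A commuting move: interchange two adjacent letters `i`, `j` which are neither equal nor
neighbours mod `n`. -/
inductive CommutingMove {n : ℕ} : List (ZMod n) → List (ZMod n) → Prop
  | swap (a b : List (ZMod n)) (i j : ZMod n) (h₀ : i ≠ j) (h₁ : i ≠ j + 1) (h₂ : j ≠ i + 1) :
      CommutingMove (a ++ i :: j :: b) (a ++ j :: i :: b)

/-- `w` is fully commutative: any reduced expression for `w` can be obtained from any other by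
commuting moves, i.e. the reduced expressions form a single commutativity class. -/
def IsFullyCommutative {n : ℕ} (w : affineSymmetricGroup n) : Prop :=
  ∀ l l' : List (ZMod n), IsReducedWord w l → IsReducedWord w l' →
    Relation.ReflTransGen CommutingMove l l'

/-- The fully commutative elements of length `i`. -/
def fcOfLength (n i : ℕ) : Set (affineSymmetricGroup n) :=
  {w | IsFullyCommutative w ∧ length w = i}

/-- The length generating function `f_n(q) = ∑ q ^ ℓ(w)` over the fully commutative `w`: its
coefficient at `q ^ i` is the number of fully commutative elements of length `i`. -/
noncomputable def fcGenFun (n : ℕ) : PowerSeries ℕ :=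
  PowerSeries.mk fun i => (fcOfLength n i).ncard

/-- `m ≥ 1` is a period of the sequence `a` from some index on. -/
def IsEventualPeriod (a : ℕ → ℕ) (m : ℕ) : Prop :=
  0 < m ∧ ∃ N, ∀ i ≥ N, a (i + m) = a i

end AffineSymmetric

namespace AffineSymmetric

/-! ### Action of the generators on `ℤ` -/

variable {n : ℕ}

/-! For `n ≥ 2`, an element is fully commutative exactly when it avoids the pattern 321
(`isFullyCommutative_iff_avoids`). A 321-avoiding `w` is increasing on the integers that it moves
right and increasing on the others, and its length is the sum of its positive displacements over a
window (`Avoids.length_eq`).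

Let `A` be the set of residues of the integers moved right and `B` the set of residues of their
images. Then `w` is determined by `A`, `B` and two shifts, one matching the enumerations of `A` and
`B`, one matching those of the complements. The length fixes the first shift and the normalisation
of the window sum fixes the second. Reducing the length formula mod `n` gives `∑ B - ∑ A = i` for
`w` of length `i`, so for `i > 0` the fully commutative elements of length `i` inject into
`residuePairs n i`. Conversely, once `i` is large, the shifts are large enough for every such pair
to occur. The count therefore depends only on `i` mod `n` from some point on.

For `n = p` prime, `A.card` is invertible mod `p`, so translating `B` makes all fibres `residuePairs
p r` equinumerous. Together they contain all pairs of equinumerous subsets except the two trivial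
ones, that is `(2p choose p) - 2` pairs. -/

theorem apply_add_mul (w : affineSymmetricGroup n) (x k : ℤ) :
    w.1 (x + k * n) = w.1 x + k * n :=
  map_add_mul w.2.1 x k

theorem inv_apply_add_mul (w : affineSymmetricGroup n) (x k : ℤ) :
    w.1⁻¹ (x + k * n) = w.1⁻¹ x + k * n :=
  map_add_mul (inv_map_add w.2.1) x k

theorem apply_inv_apply (w : affineSymmetricGroup n) (x : ℤ) : w.1 (w.1⁻¹ x) = x :=
  w.1.apply_symm_apply x

theorem inv_apply_apply (w : affineSymmetricGroup n) (x : ℤ) : w.1⁻¹ (w.1 x) = x :=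
  w.1.symm_apply_apply x

theorem intCast_eq_iff_exists (x y : ℤ) : (x : ZMod n) = y ↔ ∃ k : ℤ, x = y + k * n := by
  rw [ZMod.intCast_eq_intCast_iff_dvd_sub]
  constructor
  · rintro ⟨k, hk⟩
    exact ⟨-k, by linarith⟩
  · rintro ⟨k, hk⟩
    exact ⟨-k, by rw [hk]; ring⟩

/-- Congruent values come from positions differing by the same multiple of `n`, hence in the same
order. -/
theorem apply_ne_of_inversion (w : affineSymmetricGroup n) {x y : ℤ} (hxy : x < y)
    (h : w.1 y < w.1 x) : (w.1 x : ZMod n) ≠ w.1 y := by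
  intro e
  obtain ⟨k, hk⟩ := (intCast_eq_iff_exists _ _).1 e
  have hx : x = y + k * n := by
    apply w.1.injective
    rw [apply_add_mul, hk]
  linarith

theorem simple_of_eq (hn : 2 ≤ n) {b : ZMod n} {x : ℤ} (h : (x : ZMod n) = b) :
    (simple n b).1 x = x + 1 := by
  have : Fact (1 < n) := ⟨hn⟩
  change simpleFun n b x = _
  rw [simpleFun, if_pos h, if_neg (by simp [h])]
  ring

theorem simple_of_eq_add_one (hn : 2 ≤ n) {b : ZMod n} {x : ℤ} (h : (x : ZMod n) = b + 1) :
    (simple n b).1 x = x - 1 := by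
  have : Fact (1 < n) := ⟨hn⟩
  change simpleFun n b x = _
  rw [simpleFun, if_pos h, if_neg (by simp [h])]
  ring

theorem simple_of_ne {b : ZMod n} {x : ℤ} (h : (x : ZMod n) ≠ b) (h' : (x : ZMod n) ≠ b + 1) :
    (simple n b).1 x = x := by
  change simpleFun n b x = _
  rw [simpleFun, if_neg h, if_neg h']
  ring

theorem simple_mul_self (b : ZMod n) : simple n b * simple n b = 1 := by
  apply Subtype.ext
  apply Equiv.ext
  exact simpleFun_involutive n b

theorem simple_mul_cancel_left (b : ZMod n) (w : affineSymmetricGroup n) :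
    simple n b * (simple n b * w) = w := by
  rw [← mul_assoc, simple_mul_self, one_mul]

theorem simple_simple_apply (b : ZMod n) (x : ℤ) : (simple n b).1 ((simple n b).1 x) = x :=
  simpleFun_involutive n b x

theorem mul_apply (u w : affineSymmetricGroup n) (x : ℤ) : (u * w).1 x = u.1 (w.1 x) := rfl

theorem simple_mul_inv_apply (b : ZMod n) (w : affineSymmetricGroup n) (x : ℤ) :
    (simple n b * w).1⁻¹ x = w.1⁻¹ ((simple n b).1 x) := by
  apply (simple n b * w).1.injective
  rw [apply_inv_apply, mul_apply, apply_inv_apply, simple_simple_apply]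

/-- A generator reverses the order only of the pairs of neighbours that it interchanges. -/
theorem simple_lt_simple (hn : 2 ≤ n) {b : ZMod n} {u v : ℤ} (huv : u < v)
    (h : ¬ (v = u + 1 ∧ (u : ZMod n) = b)) : (simple n b).1 u < (simple n b).1 v := by
  have : Fact (1 < n) := ⟨hn⟩
  by_cases hu : (u : ZMod n) = b
  · rw [simple_of_eq hn hu]
    have h1 : v ≠ u + 1 := fun e => h ⟨e, hu⟩
    by_cases hv : (v : ZMod n) = b + 1
    · rw [simple_of_eq_add_one hn hv]
      have h2 : v ≠ u + 2 := by
        rintro rfl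
        push_cast at hv
        rw [hu] at hv
        have : (1 : ZMod n) = 0 := by linear_combination hv
        exact one_ne_zero this
      omega
    · by_cases hv' : (v : ZMod n) = b
      · rw [simple_of_eq hn hv']; omega
      · rw [simple_of_ne hv' hv]; omega
  · have h1 : (simple n b).1 u ≤ u := by
      by_cases hu' : (u : ZMod n) = b + 1
      · rw [simple_of_eq_add_one hn hu']; omega
      · rw [simple_of_ne hu hu']
    by_cases hv : (v : ZMod n) = b + 1
    · rw [simple_of_eq_add_one hn hv]
      have h2 : v ≠ u + 1 := by
        rintro rfl
        push_cast at hv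
        exact hu (add_right_cancel hv)
      omega
    · by_cases hv' : (v : ZMod n) = b
      · rw [simple_of_eq hn hv']; omega
      · rw [simple_of_ne hv' hv]; omega

/-! ### Descents, the exchange property and reduced words -/

/-- `b` is a left descent of `w`: the value `b + 1` occurs before the value `b`. -/
def IsDescent (w : affineSymmetricGroup n) (b : ℤ) : Prop := w.1⁻¹ (b + 1) < w.1⁻¹ b

theorem wordProd_cons (a : ZMod n) (l : List (ZMod n)) :
    wordProd n (a :: l) = simple n a * wordProd n l := by
  simp [wordProd]

theorem wordProd_append (l l' : List (ZMod n)) :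
    wordProd n (l ++ l') = wordProd n l * wordProd n l' := by
  simp [wordProd]

theorem wordProd_nil : wordProd n [] = 1 := by simp [wordProd]

/-- Every inversion of a product of generators is created by one of the factors. -/
theorem exists_crossing (hn : 2 ≤ n) {x y : ℤ} (hxy : x < y) (l : List (ZMod n))
    (h : (wordProd n l).1 y < (wordProd n l).1 x) :
    ∃ l₁ a l₂, l = l₁ ++ a :: l₂ ∧ ((wordProd n l₂).1 x : ZMod n) = a ∧
      (wordProd n l₂).1 y = (wordProd n l₂).1 x + 1 := by
  induction l with
  | nil =>
    rw [wordProd_nil] at h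
    exact absurd h (not_lt.2 hxy.le)
  | cons a l ih =>
    rcases lt_or_ge ((wordProd n l).1 y) ((wordProd n l).1 x) with h1 | h1
    · obtain ⟨l₁, c, l₂, e, h2⟩ := ih h1
      exact ⟨a :: l₁, c, l₂, by rw [e]; rfl, h2⟩
    · have h1' : (wordProd n l).1 x < (wordProd n l).1 y :=
        lt_of_le_of_ne h1 fun e => hxy.ne ((wordProd n l).1.injective e)
      have h2 := mt (simple_lt_simple hn (b := a) h1')
        (by rw [wordProd_cons] at h; exact not_lt.2 h.le)
      rw [not_not] at h2
      exact ⟨[], a, l, rfl, h2.2, h2.1⟩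

/-- Conjugating a swap of positions by `u` gives the swap of their images. -/
theorem simple_mul_eq_mul_simple (hn : 2 ≤ n) (u : affineSymmetricGroup n) {p b : ℤ}
    (h : u.1 p = b) (h' : u.1 (p + 1) = b + 1) : simple n b * u = u * simple n p := by
  apply Subtype.ext
  apply Equiv.ext
  intro z
  change (simple n b).1 (u.1 z) = u.1 ((simple n p).1 z)
  by_cases hz : (z : ZMod n) = p
  · rw [simple_of_eq hn hz]
    obtain ⟨k, rfl⟩ := (intCast_eq_iff_exists _ _).1 hz
    rw [show p + k * n + 1 = p + 1 + k * n by ring, apply_add_mul, apply_add_mul u, h, h',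
      simple_of_eq hn (by simp)]
    ring
  by_cases hz' : (z : ZMod n) = p + 1
  · rw [simple_of_eq_add_one hn hz']
    obtain ⟨k, rfl⟩ := (intCast_eq_iff_exists z (p + 1)).1 (by simpa using hz')
    rw [show p + 1 + k * n - 1 = p + k * n by ring, apply_add_mul, apply_add_mul u, h, h',
      simple_of_eq_add_one hn (by simp)]
    ring
  · rw [simple_of_ne hz hz', simple_of_ne]
    · intro e
      obtain ⟨k, hk⟩ := (intCast_eq_iff_exists _ _).1 e
      rw [← h, ← apply_add_mul] at hk
      exact hz (by rw [u.1.injective hk]; simp)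
    · intro e
      obtain ⟨k, hk⟩ := (intCast_eq_iff_exists (u.1 z) (b + 1)).1 (by simpa using e)
      rw [← h', ← apply_add_mul] at hk
      exact hz' (by rw [u.1.injective hk]; simp)

/-- Some letter creates the inversion between the values `b + 1` and `b`. Moving `s_b` through the
prefix before that letter turns it into the same generator, and the two cancel. -/
theorem exchange (hn : 2 ≤ n) {b : ℤ} (l : List (ZMod n)) (h : IsDescent (wordProd n l) b) :
    ∃ l' : List (ZMod n), wordProd n l' = simple n b * wordProd n l ∧
      l'.length + 1 = l.length := by
  obtain ⟨l₁, a, l₂, e, h1, h2⟩ := exists_crossing hn h l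
    (by rw [apply_inv_apply, apply_inv_apply]; omega)
  set x := (wordProd n l).1⁻¹ (b + 1) with hx
  set y := (wordProd n l).1⁻¹ b with hy
  refine ⟨l₁ ++ l₂, ?_, by rw [e]; simp; omega⟩
  have hwx : (wordProd n l).1 x = b + 1 := apply_inv_apply _ _
  have hwy : (wordProd n l).1 y = b := apply_inv_apply _ _
  clear_value x y
  subst e
  subst h1
  set p := (wordProd n l₂).1 x
  rw [wordProd_append, wordProd_cons, mul_apply, mul_apply] at hwx hwy
  rw [h2, simple_of_eq_add_one hn (by simp [p])] at hwy
  rw [simple_of_eq hn rfl] at hwx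
  rw [wordProd_append, wordProd_append, wordProd_cons, ← mul_assoc,
    simple_mul_eq_mul_simple hn (wordProd n l₁) (p := p) (b := b) (by simpa using hwy) hwx,
    mul_assoc, ← mul_assoc (simple n p), simple_mul_self, one_mul]

theorem length_le {w : affineSymmetricGroup n} {l : List (ZMod n)} (h : wordProd n l = w) :
    length w ≤ l.length :=
  Nat.sInf_le ⟨l, h, rfl⟩

theorem length_one : length (1 : affineSymmetricGroup n) = 0 :=
  Nat.le_zero.1 (length_le (l := []) wordProd_nil)

theorem exists_mem_window (hn : 1 ≤ n) (x : ℤ) : ∃ k : ℤ, x + k * n ∈ Finset.Icc (1 : ℤ) n := by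
  have hn' : (0 : ℤ) < n := by exact_mod_cast hn
  refine ⟨-((x - 1) / n), ?_⟩
  have h := Int.emod_add_mul_ediv (x - 1) n
  have h1 := Int.emod_nonneg (x - 1) hn'.ne'
  have h2 := Int.emod_lt_of_pos (x - 1) hn'
  rw [Finset.mem_Icc]
  constructor <;> linarith

theorem sum_window_ite (hn : 1 ≤ n) (b : ℤ) (c : ℤ) :
    ∑ v ∈ Finset.Icc (1 : ℤ) n, (if (v : ZMod n) = b then c else 0) = c := by
  obtain ⟨k, hk⟩ := exists_mem_window hn b
  rw [Finset.sum_eq_single_of_mem (b + k * n) hk, if_pos (by simp)]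
  intro v hv hne
  rw [if_neg]
  intro e
  obtain ⟨j, rfl⟩ := (intCast_eq_iff_exists _ _).1 e
  rw [Finset.mem_Icc] at hv hk
  apply hne
  have hjk : j = k := by
    have hn' : (0 : ℤ) < n := by exact_mod_cast hn
    apply le_antisymm
    · by_contra hlt
      have : (k + 1) * (n : ℤ) ≤ j * n := mul_le_mul_of_nonneg_right (by omega) hn'.le
      linarith
    · by_contra hlt
      have : (j + 1) * (n : ℤ) ≤ k * n := mul_le_mul_of_nonneg_right (by omega) hn'.le
      linarith
  rw [hjk]

/-- The sum over one window of a function of the displacements of `w`. -/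
noncomputable def displacementSum (φ : ℤ → ℤ) (w : affineSymmetricGroup n) : ℤ :=
  ∑ x ∈ Finset.Icc (1 : ℤ) n, φ (w.1 x - x)

/-- Indexed by values instead of positions, the two sums differ only at the residues `b` and `b +
1`. -/
theorem displacementSum_simple_mul (hn : 2 ≤ n) (φ : ℤ → ℤ) (w : affineSymmetricGroup n) (b : ℤ) :
    displacementSum φ (simple n b * w) = displacementSum φ w
      + (φ (b + 1 - w.1⁻¹ b) - φ (b - w.1⁻¹ b))
      + (φ (b - w.1⁻¹ (b + 1)) - φ (b + 1 - w.1⁻¹ (b + 1))) := by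
  have : Fact (1 < n) := ⟨hn⟩
  have hinv := inv_map_add w.2.1
  have h1 : displacementSum φ w = ∑ v ∈ Finset.Icc (1 : ℤ) n, φ (v - w.1⁻¹ v) := by
    rw [← sum_comp_eq w.2.1 (fun v => φ (v - w.1⁻¹ v))
      (fun v => by simp only [hinv, add_sub_add_right_eq_sub])]
    simp only [inv_apply_apply, displacementSum]
  have h2 : displacementSum φ (simple n b * w) =
      ∑ v ∈ Finset.Icc (1 : ℤ) n, φ ((simple n b).1 v - w.1⁻¹ v) := by
    rw [← sum_comp_eq w.2.1 (fun v => φ ((simple n b).1 v - w.1⁻¹ v))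
      (fun v => by simp only [hinv, (simple n (b : ZMod n)).2.1, add_sub_add_right_eq_sub])]
    simp only [inv_apply_apply, displacementSum, mul_apply]
  rw [h1, h2, add_assoc, ← sub_eq_iff_eq_add', ← Finset.sum_sub_distrib,
    ← sum_window_ite (n := n) (by omega) b (φ (b + 1 - w.1⁻¹ b) - φ (b - w.1⁻¹ b)),
    ← sum_window_ite (n := n) (by omega) (b + 1) (φ (b - w.1⁻¹ (b + 1)) - φ (b + 1 - w.1⁻¹ (b + 1))),
    ← Finset.sum_add_distrib]
  refine Finset.sum_congr rfl fun v _ => ?_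
  push_cast
  by_cases hv : (v : ZMod n) = b
  · rw [simple_of_eq hn hv, if_pos hv, if_neg (by simp [hv]), add_zero]
    obtain ⟨k, rfl⟩ := (intCast_eq_iff_exists _ _).1 hv
    rw [inv_apply_add_mul]
    congr 2 <;> ring
  by_cases hv' : (v : ZMod n) = b + 1
  · rw [simple_of_eq_add_one hn hv', if_pos hv', if_neg hv, zero_add]
    obtain ⟨k, rfl⟩ := (intCast_eq_iff_exists v (b + 1)).1 (by simpa using hv')
    rw [inv_apply_add_mul]
    congr 2 <;> ring
  · rw [simple_of_ne hv hv', if_neg hv, if_neg hv']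
    ring

/-- A jump of more than one would leave the value `σ j + 1` unattained. -/
theorem eq_add_of_strictMono_of_surjective {σ : ℤ → ℤ} (h : StrictMono σ)
    (hs : Function.Surjective σ) (j : ℤ) : σ j = j + σ 0 := by
  have step : ∀ j, σ (j + 1) = σ j + 1 := fun j => by
    obtain ⟨m, hm⟩ := hs (σ j + 1)
    have h1 : j < m := h.lt_iff_lt.1 (by omega)
    have h2 : σ (j + 1) ≤ σ m := h.monotone (by omega)
    have h3 : σ j < σ (j + 1) := h (by omega)
    omega
  induction j using Int.induction_on with
  | zero => simp
  | succ k ih => rw [step, ih]; ring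
  | pred k ih =>
    have := step (-(k : ℤ) - 1)
    rw [sub_add_cancel, ih] at this
    linarith

/-- Without descents `w⁻¹` is increasing, hence a translation, and the window sum forces it to be
trivial. -/
theorem exists_isDescent (hn : 1 ≤ n) {w : affineSymmetricGroup n} (hw : w ≠ 1) :
    ∃ b, IsDescent w b := by
  by_contra! hno
  apply hw
  have hmono : StrictMono ⇑w.1⁻¹ := strictMono_int_of_lt_succ fun b =>
    lt_of_le_of_ne (not_lt.1 (hno b)) fun e => by
      have := w.1⁻¹.injective e
      omega
  have htr := eq_add_of_strictMono_of_surjective hmono w.1⁻¹.surjective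
  have hsum := (w⁻¹).2.2
  change ∑ i ∈ Finset.Icc (1 : ℤ) n, w.1⁻¹ i = _ at hsum
  rw [Finset.sum_congr rfl fun i _ => htr i, Finset.sum_add_distrib, Finset.sum_const,
    Int.card_Icc] at hsum
  have h0 : w.1⁻¹ 0 = 0 := by
    have : n • w.1⁻¹ 0 = 0 := by simpa using hsum
    rcases smul_eq_zero.1 this with h | h
    · omega
    · exact h
  rw [← inv_eq_one]
  apply Subtype.ext
  apply Equiv.ext
  intro x
  change w.1⁻¹ x = x
  rw [htr, h0, add_zero]

/-- At a descent `b`, multiplying by `s_b` changes the sum of squared displacements by `2 (w⁻¹ (b +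
1) - w⁻¹ b) < 0`, so the descent procedure ends at the identity. -/
theorem exists_wordProd_eq (hn : 2 ≤ n) (w : affineSymmetricGroup n) :
    ∃ l, wordProd n l = w := by
  induction hN : (displacementSum (fun d => d ^ 2) w).toNat using Nat.strong_induction_on
    generalizing w with
  | _ N ih =>
    by_cases hw : w = 1
    · exact ⟨[], by rw [wordProd_nil, hw]⟩
    obtain ⟨b, hb⟩ := exists_isDescent (by omega) hw
    have h1 := displacementSum_simple_mul hn (fun d => d ^ 2) w b
    have h2 : 0 ≤ displacementSum (fun d => d ^ 2) (simple n b * w) :=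
      Finset.sum_nonneg fun _ _ => sq_nonneg _
    have h3 : displacementSum (fun d => d ^ 2) (simple n b * w) <
        displacementSum (fun d => d ^ 2) w := by
      unfold IsDescent at hb
      rw [h1]
      nlinarith
    obtain ⟨l, hl⟩ := ih _ (by omega) (simple n b * w) rfl
    exact ⟨(b : ZMod n) :: l, by rw [wordProd_cons, hl, simple_mul_cancel_left]⟩

theorem exists_isReducedWord (hn : 2 ≤ n) (w : affineSymmetricGroup n) :
    ∃ l, IsReducedWord w l := by
  obtain ⟨l, hl⟩ := exists_wordProd_eq hn w
  exact Nat.sInf_mem (s := {k | ∃ l : List (ZMod n), wordProd n l = w ∧ l.length = k})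
    ⟨_, l, hl, rfl⟩

theorem length_simple_mul (hn : 2 ≤ n) {w : affineSymmetricGroup n} {b : ℤ}
    (h : IsDescent w b) : length (simple n b * w) + 1 = length w := by
  obtain ⟨l, hl, hlen⟩ := exists_isReducedWord hn w
  obtain ⟨l', hl', hlen'⟩ := exchange hn l (hl.symm ▸ h)
  rw [hl] at hl'
  have h1 := length_le hl'
  obtain ⟨t, ht, htlen⟩ := exists_isReducedWord hn (simple n b * w)
  have h2 := length_le (w := w) (l := (b : ZMod n) :: t)
    (by rw [wordProd_cons, ht, simple_mul_cancel_left])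
  rw [List.length_cons] at h2
  omega

theorem isDescent_simple_mul (hn : 2 ≤ n) {w : affineSymmetricGroup n} {b : ℤ} :
    IsDescent (simple n b * w) b ↔ ¬ IsDescent w b := by
  unfold IsDescent
  rw [simple_mul_inv_apply, simple_mul_inv_apply, simple_of_eq hn rfl,
    simple_of_eq_add_one hn (by simp), add_sub_cancel_right]
  have : w.1⁻¹ b ≠ w.1⁻¹ (b + 1) := fun e => by
    have := w.1⁻¹.injective e
    omega
  omega

theorem IsReducedWord.cons (hn : 2 ≤ n) {w : affineSymmetricGroup n} {b : ℤ}
    (h : IsDescent w b) {l : List (ZMod n)} (hl : IsReducedWord (simple n b * w) l) :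
    IsReducedWord w ((b : ZMod n) :: l) := by
  refine ⟨by rw [wordProd_cons, hl.1, simple_mul_cancel_left], ?_⟩
  rw [List.length_cons, hl.2, length_simple_mul hn h]

theorem IsReducedWord.isDescent (hn : 2 ≤ n) {w : affineSymmetricGroup n} {b : ℤ}
    {l : List (ZMod n)} (hl : IsReducedWord w ((b : ZMod n) :: l)) : IsDescent w b := by
  by_contra h
  have h1 := length_simple_mul hn ((isDescent_simple_mul hn).2 h)
  rw [simple_mul_cancel_left] at h1
  have h2 := length_le (w := simple n b * w) (l := l)
    (by rw [← hl.1, wordProd_cons, simple_mul_cancel_left])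
  have h3 := hl.2
  rw [List.length_cons] at h3
  omega

theorem IsReducedWord.tail (hn : 2 ≤ n) {w : affineSymmetricGroup n} {b : ℤ}
    {l : List (ZMod n)} (hl : IsReducedWord w ((b : ZMod n) :: l)) :
    IsReducedWord (simple n b * w) l := by
  have h1 := length_simple_mul hn (hl.isDescent hn)
  have h2 := hl.2
  rw [List.length_cons] at h2
  exact ⟨by rw [← hl.1, wordProd_cons, simple_mul_cancel_left], by omega⟩

/-! ### Full commutativity is 321-avoidance -/

/-- `w` avoids the pattern 321. -/
def Avoids (w : affineSymmetricGroup n) : Prop :=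
  ∀ x y z, x < y → y < z → w.1 y < w.1 x → w.1 z < w.1 y → False

/-- Multiplying by `s_b` at a descent only removes inversions: the pairs whose order it changes were
inverted in `w`. -/
theorem Avoids.simple_mul (hn : 2 ≤ n) {w : affineSymmetricGroup n} (h : Avoids w) {b : ℤ}
    (hb : IsDescent w b) : Avoids (simple n b * w) := by
  have key : ∀ p q, p < q → (simple n b * w).1 q < (simple n b * w).1 p → w.1 q < w.1 p := by
    intro p q hpq hlt
    have h1 := simple_lt_simple hn (b := (b : ZMod n)) hlt
    rw [mul_apply, mul_apply, simple_simple_apply, simple_simple_apply] at h1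
    by_contra hno
    have h2 := not_imp_comm.1 h1 hno
    obtain ⟨k, hk⟩ := (intCast_eq_iff_exists _ _).1 h2.2
    have hq : q = w.1⁻¹ (b + 1) + k * n := by
      apply w.1.injective
      have := simple_simple_apply (b : ZMod n) (w.1 q)
      rw [hk, simple_of_eq hn (by simp)] at this
      rw [apply_add_mul, apply_inv_apply, ← this]
      ring
    have hp : p = w.1⁻¹ b + k * n := by
      apply w.1.injective
      have := simple_simple_apply (b : ZMod n) (w.1 p)
      rw [h2.1, hk, simple_of_eq_add_one hn (by simp)] at this
      rw [apply_add_mul, apply_inv_apply, ← this]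
      ring
    unfold IsDescent at hb
    omega
  intro x y z hxy hyz h1 h2
  exact h x y z hxy hyz (key _ _ hxy h1) (key _ _ hyz h2)

/-- Generators at distance at least two commute, so they do not affect each other's descents. -/
theorem isDescent_simple_mul_of_ne {w : affineSymmetricGroup n} {a b : ℤ}
    (h₀ : (a : ZMod n) ≠ b) (h₁ : (a : ZMod n) ≠ b + 1) (h₂ : (b : ZMod n) ≠ a + 1)
    (h : IsDescent w b) : IsDescent (simple n a * w) b := by
  unfold IsDescent at h ⊢
  rwa [simple_mul_inv_apply, simple_mul_inv_apply, simple_of_ne h₀.symm h₂,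
    simple_of_ne (by push_cast; exact h₁.symm)
      (by push_cast; exact fun e => h₀ (add_right_cancel e).symm)]

theorem simple_comm (hn : 2 ≤ n) {i j : ZMod n} (h₀ : i ≠ j) (h₁ : i ≠ j + 1) (h₂ : j ≠ i + 1) :
    simple n i * simple n j = simple n j * simple n i := by
  obtain ⟨b, rfl⟩ := ZMod.intCast_surjective j
  refine (simple_mul_eq_mul_simple hn (simple n i) (simple_of_ne h₀.symm h₂) ?_).symm
  exact simple_of_ne (by push_cast; exact h₁.symm)
    (by push_cast; exact fun e => h₀ (add_right_cancel e).symm)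

/-- Otherwise, after a shift by a multiple of `n`, the values `b + 2`, `b + 1`, `b` would occur in
this order. -/
theorem Avoids.not_isDescent_add_one {w : affineSymmetricGroup n} (h : Avoids w) {a b : ℤ}
    (ha : IsDescent w a) (hb : IsDescent w b) : (a : ZMod n) ≠ b + 1 := by
  intro e
  obtain ⟨k, rfl⟩ := (intCast_eq_iff_exists a (b + 1)).1 (by simpa using e)
  unfold IsDescent at ha hb
  rw [show b + 1 + k * n + 1 = b + 1 + 1 + k * n by ring, inv_apply_add_mul,
    inv_apply_add_mul] at ha
  refine h _ _ _ (lt_of_add_lt_add_right ha) hb ?_ ?_ <;> simp only [apply_inv_apply] <;> omega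

theorem reflTransGen_commutingMove_cons {l l' : List (ZMod n)}
    (h : Relation.ReflTransGen CommutingMove l l') (a : ZMod n) :
    Relation.ReflTransGen CommutingMove (a :: l) (a :: l') := by
  refine h.lift (fun l => a :: l) ?_
  rintro _ _ ⟨c, d, i, j, h₀, h₁, h₂⟩
  exact CommutingMove.swap (a :: c) d i j h₀ h₁ h₂

/-- The first letters `a`, `b` of two reduced words are descents, so they are equal or commute. In
the second case both words connect, by induction on their tails, to `a b s` and `b a s`, where `s`
is a reduced word of `s_b s_a w`. -/
theorem Avoids.isFullyCommutative (hn : 2 ≤ n) {w : affineSymmetricGroup n} (h : Avoids w) :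
    IsFullyCommutative w := by
  intro l
  induction hN : l.length using Nat.strong_induction_on generalizing w l with
  | _ N ih =>
    intro l' hl hl'
    have hlen : l.length = l'.length := hl.2.trans hl'.2.symm
    match l, l' with
    | [], [] => exact Relation.ReflTransGen.refl
    | a :: t, b :: t' =>
      rw [List.length_cons] at hN
      obtain ⟨a, rfl⟩ := ZMod.intCast_surjective a
      obtain ⟨b, rfl⟩ := ZMod.intCast_surjective b
      have da := hl.isDescent hn
      have db := hl'.isDescent hn
      have ht := hl.tail hn
      have ht' := hl'.tail hn
      have hlen' : t'.length = t.length := by simpa using hlen.symm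
      by_cases hab : (a : ZMod n) = b
      · rw [← hab] at ht' ⊢
        exact reflTransGen_commutingMove_cons
          (ih t.length (by omega) (h.simple_mul hn da) t rfl _ ht ht') _
      have h₁ := h.not_isDescent_add_one da db
      have h₂ := h.not_isDescent_add_one db da
      have hdb := isDescent_simple_mul_of_ne hab h₁ h₂ db
      have hda := isDescent_simple_mul_of_ne (Ne.symm hab) h₂ h₁ da
      obtain ⟨s, hs⟩ := exists_isReducedWord hn (simple n b * (simple n a * w))
      have hs' : IsReducedWord (simple n a * (simple n b * w)) s := by
        rwa [← mul_assoc, simple_comm hn hab h₁ h₂, mul_assoc]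
      have r1 := reflTransGen_commutingMove_cons
        (ih t.length (by omega) (h.simple_mul hn da) t rfl _ ht (hs.cons hn hdb)) (a : ZMod n)
      have hlens : ((a : ZMod n) :: s).length = t.length := by
        rw [(hs'.cons hn hda).2, ← ht'.2, hlen']
      have r2 := reflTransGen_commutingMove_cons
        (ih t.length (by omega) (h.simple_mul hn db) _ hlens _ (hs'.cons hn hda) ht') (b : ZMod n)
      exact r1.trans (Relation.ReflTransGen.head (CommutingMove.swap [] s _ _ hab h₁ h₂) r2)

theorem perm_of_reflTransGen_commutingMove {l l' : List (ZMod n)}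
    (h : Relation.ReflTransGen CommutingMove l l') : l.Perm l' := by
  induction h with
  | refl => exact List.Perm.refl _
  | tail _ h ih =>
    obtain ⟨c, d, i, j⟩ := h
    exact ih.trans (List.Perm.append_left _ (List.Perm.swap _ _ _))

/-- For `n = 2` the residues `a` and `a + 2` coincide and the relation fails. -/
theorem braid (hn : 3 ≤ n) (a : ZMod n) :
    simple n a * (simple n (a + 1) * simple n a) =
      simple n (a + 1) * (simple n a * simple n (a + 1)) := by
  have hn2 : 2 ≤ n := by omega
  have : Fact (1 < n) := ⟨hn2⟩
  have htwo : (2 : ZMod n) ≠ 0 := by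
    intro e
    have := (ZMod.natCast_eq_zero_iff 2 n).1 (by exact_mod_cast e)
    exact absurd (Nat.le_of_dvd (by norm_num) this) (by omega)
  have hone : (1 : ZMod n) ≠ 0 := one_ne_zero
  apply Subtype.ext
  apply Equiv.ext
  intro z
  simp only [mul_apply]
  have n1 : a ≠ a + 1 + 1 := fun e => htwo (by linear_combination -e)
  have n2 : a ≠ a + 1 := fun e => hone (by linear_combination -e)
  have n3 : a + 1 ≠ a + 1 + 1 := fun e => hone (by linear_combination -e)
  by_cases h0 : (z : ZMod n) = a
  · have c1 : ((z + 1 : ℤ) : ZMod n) = a + 1 := by push_cast; rw [h0]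
    have c2 : ((z + 1 + 1 : ℤ) : ZMod n) = a + 1 + 1 := by push_cast; rw [h0]
    rw [simple_of_eq hn2 h0, simple_of_eq hn2 c1,
      simple_of_ne (x := z + 1 + 1) (by rw [c2]; exact n1.symm) (by rw [c2]; exact n3.symm),
      simple_of_ne (x := z) (by rw [h0]; exact n2) (by rw [h0]; exact n1),
      simple_of_eq hn2 h0, simple_of_eq hn2 c1]
  by_cases h1 : (z : ZMod n) = a + 1
  · have c1 : ((z + 1 : ℤ) : ZMod n) = a + 1 + 1 := by push_cast; rw [h1]
    have c0 : ((z - 1 : ℤ) : ZMod n) = a := by push_cast; rw [h1]; ring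
    rw [simple_of_eq_add_one hn2 h1, simple_of_eq hn2 h1,
      simple_of_ne (x := z - 1) (by rw [c0]; exact n2) (by rw [c0]; exact n1),
      simple_of_ne (x := z + 1) (by rw [c1]; exact n1.symm) (by rw [c1]; exact n3.symm),
      simple_of_eq hn2 c0, simple_of_eq_add_one hn2 c1]
    ring
  by_cases h2 : (z : ZMod n) = a + 1 + 1
  · have c1 : ((z - 1 : ℤ) : ZMod n) = a + 1 := by push_cast; rw [h2]; ring
    have c0 : ((z - 1 - 1 : ℤ) : ZMod n) = a := by push_cast; rw [h2]; ring
    rw [simple_of_ne (b := a) (x := z) h0 h1, simple_of_eq_add_one hn2 h2,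
      simple_of_eq_add_one hn2 c1,
      simple_of_ne (x := z - 1 - 1) (by rw [c0]; exact n2) (by rw [c0]; exact n1)]
  · rw [simple_of_ne (b := a) (x := z) h0 h1, simple_of_ne (b := a + 1) (x := z) h1 h2,
      simple_of_ne (b := a) (x := z) h0 h1, simple_of_ne (b := a + 1) (x := z) h1 h2]

theorem inv_eq_of_apply_eq {w : affineSymmetricGroup n} {x v : ℤ} (h : w.1 x = v) :
    w.1⁻¹ v = x := by
  rw [← h, inv_apply_apply]

/-- The two sides of the braid relation both start reduced words of `w`, and they contain the letter
`b` twice and once. Commuting moves preserve the multiset of letters. -/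
theorem exists_not_perm_of_consecutive (hn : 2 ≤ n) {w : affineSymmetricGroup n} {x y z b : ℤ}
    (hxy : x < y) (hyz : y < z) (hx : w.1 x = b + 1 + 1) (hy : w.1 y = b + 1) (hz : w.1 z = b) :
    ∃ l l', IsReducedWord w l ∧ IsReducedWord w l' ∧ ¬ l.Perm l' := by
  have : Fact (1 < n) := ⟨hn⟩
  have hne : ((b + 1 + 1 : ℤ) : ZMod n) ≠ b := by
    have := apply_ne_of_inversion w (hxy.trans hyz) (by rw [hx, hz]; omega)
    rwa [hx, hz] at this
  have hn3 : 3 ≤ n := by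
    rcases hn.lt_or_eq with h | h
    · exact h
    · subst h
      refine absurd ?_ hne
      push_cast
      rw [add_assoc]
      have : (1 + 1 : ZMod 2) = 0 := rfl
      rw [this, add_zero]
  have s0 {v : ℤ} (h : v = b) : (simple n (b : ZMod n)).1 v = b + 1 := by
    rw [simple_of_eq hn (by rw [h]), h]
  have s1 {v : ℤ} (h : v = b + 1) : (simple n (b : ZMod n)).1 v = b := by
    rw [simple_of_eq_add_one hn (by rw [h]; simp), h]; ring
  have s2 {v : ℤ} (h : v = b + 1 + 1) : (simple n (b : ZMod n)).1 v = b + 1 + 1 := by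
    rw [simple_of_ne (by rw [h]; exact hne) (by rw [h]; simp), h]
  have t0 {v : ℤ} (h : v = b) : (simple n ((b + 1 : ℤ) : ZMod n)).1 v = b := by
    rw [simple_of_ne (by rw [h]; simp) (by rw [h]; simpa using hne.symm), h]
  have t1 {v : ℤ} (h : v = b + 1) : (simple n ((b + 1 : ℤ) : ZMod n)).1 v = b + 1 + 1 := by
    rw [simple_of_eq hn (by rw [h]), h]
  have t2 {v : ℤ} (h : v = b + 1 + 1) : (simple n ((b + 1 : ℤ) : ZMod n)).1 v = b + 1 := by
    rw [simple_of_eq_add_one hn (by rw [h]; simp), h]; ring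
  have hx' := inv_eq_of_apply_eq hx
  have hy' := inv_eq_of_apply_eq hy
  have hz' := inv_eq_of_apply_eq hz
  have hbr := braid hn3 (b : ZMod n)
  rw [show (b : ZMod n) + 1 = ((b + 1 : ℤ) : ZMod n) by push_cast; rfl] at hbr
  obtain ⟨t, ht⟩ := exists_isReducedWord hn
    (simple n b * (simple n (b + 1 : ℤ) * (simple n b * w)))
  have ht' : IsReducedWord
      (simple n (b + 1 : ℤ) * (simple n b * (simple n (b + 1 : ℤ) * w))) t := by
    have e : simple n b * (simple n (b + 1 : ℤ) * (simple n b * w)) =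
        simple n (b + 1 : ℤ) * (simple n b * (simple n (b + 1 : ℤ) * w)) := by
      simpa only [mul_assoc] using congrArg (· * w) hbr
    rwa [e] at ht
  refine ⟨_, _, ((ht.cons hn ?_).cons hn ?_).cons hn ?_,
    ((ht'.cons hn ?_).cons hn ?_).cons hn ?_, ?_⟩
  · simp only [IsDescent, simple_mul_inv_apply, t0, t1, s0, s2]; omega
  · simp only [IsDescent, simple_mul_inv_apply, s1, s2]; omega
  · simp only [IsDescent]; omega
  · simp only [IsDescent, simple_mul_inv_apply, s1, s2, t0, t2]; omega
  · simp only [IsDescent, simple_mul_inv_apply, t0, t1]; omega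
  · simp only [IsDescent]; omega
  · intro hp
    have hc := (List.perm_append_right_iff (l₁ := [(b : ZMod n), (b + 1 : ℤ), b])
      (l₂ := [((b + 1 : ℤ) : ZMod n), b, (b + 1 : ℤ)]) t).1 hp
    have := hc.count_eq (b : ZMod n)
    simp at this

/-- If the values of a 321 pattern are not consecutive, look at the position `p` of the value just
below the top one or just above the bottom one. Either `p` replaces an end of the pattern, narrowing
its range of values, or there is a descent whose removal keeps the pattern and shortens `w`. -/
theorem exists_not_perm (hn : 2 ≤ n) {w : affineSymmetricGroup n} (hw : ¬ Avoids w) :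
    ∃ l l', IsReducedWord w l ∧ IsReducedWord w l' ∧ ¬ l.Perm l' := by
  induction hN : length w using Nat.strong_induction_on generalizing w with
  | _ N ih =>
    have step : ∀ b, IsDescent w b → ¬ Avoids (simple n b * w) →
        ∃ l l', IsReducedWord w l ∧ IsReducedWord w l' ∧ ¬ l.Perm l' := by
      intro b hb hav
      have hlen := length_simple_mul hn hb
      obtain ⟨l, l', h1, h2, h3⟩ := ih _ (by omega) hav rfl
      exact ⟨_, _, h1.cons hn hb, h2.cons hn hb, fun h => h3 ((List.perm_cons _).1 h)⟩
    simp only [Avoids, not_forall] at hw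
    obtain ⟨x, y, z, hxy, hyz, h1, h2, -⟩ := hw
    induction hd : (w.1 x - w.1 z).toNat using Nat.strong_induction_on generalizing x y z with
    | _ d ihd =>
      have n1 := apply_ne_of_inversion w hxy h1
      have n2 := apply_ne_of_inversion w hyz h2
      by_cases c1 : w.1 y = w.1 z + 1
      · by_cases c2 : w.1 x = w.1 y + 1
        · exact exists_not_perm_of_consecutive hn hxy hyz (by rw [c2, c1]) c1 rfl
        · set p := w.1⁻¹ (w.1 x - 1) with hp
          have hwp : w.1 p = w.1 x - 1 := apply_inv_apply _ _
          rcases lt_trichotomy p y with h | h | h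
          · exact ihd _ (by omega) p y z h hyz (by omega) h2 rfl
          · rw [h] at hwp
            omega
          · refine step (w.1 x - 1) ?_ fun hav => hav x y z hxy hyz ?_ ?_
            · rw [IsDescent, sub_add_cancel, inv_apply_apply]
              exact hxy.trans h
            · exact simple_lt_simple hn h1 fun e => c2 e.1
            -- If this generator swapped `w z` and `w y`, then `w x` would be congruent to `w y`.
            · refine simple_lt_simple hn h2 fun e => n1 ?_
              rw [c1]
              push_cast at e ⊢
              rw [e.2]
              ring
      · set p := w.1⁻¹ (w.1 z + 1) with hp
        have hwp : w.1 p = w.1 z + 1 := apply_inv_apply _ _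
        rcases lt_trichotomy p y with h | h | h
        · refine step (w.1 z) ?_ fun hav => hav x y z hxy hyz ?_ ?_
          · rw [IsDescent, inv_apply_apply]
            exact h.trans hyz
          · exact simple_lt_simple hn h1 fun e => n2 e.2
          · exact simple_lt_simple hn h2 fun e => c1 e.1
        · rw [h] at hwp
          omega
        · exact ihd _ (by omega) x y p hxy h h1 (by omega) rfl

theorem isFullyCommutative_iff_avoids (hn : 2 ≤ n) (w : affineSymmetricGroup n) :
    IsFullyCommutative w ↔ Avoids w := by
  refine ⟨fun h => ?_, fun h => h.isFullyCommutative hn⟩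
  by_contra hw
  obtain ⟨l, l', h1, h2, h3⟩ := exists_not_perm hn hw
  exact h3 (perm_of_reflTransGen_commutingMove (h l l' h1 h2))

/-! ### The length of a 321-avoiding element -/

theorem sum_window_apply_sub (w : affineSymmetricGroup n) :
    ∑ x ∈ Finset.Icc (1 : ℤ) n, (w.1 x - x) = 0 := by
  rw [Finset.sum_sub_distrib, w.2.2, sub_self]

/-- As many integers cross a given position to the left as to the right. -/
theorem exists_crossing_right (hn : 1 ≤ n) (w : affineSymmetricGroup n) {c z : ℤ} (hz : c ≤ z)
    (hwz : w.1 z < c) : ∃ y < c, c ≤ w.1 y := by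
  by_contra! hno
  have hn' : (0 : ℤ) < n := by exact_mod_cast hn
  -- `g x` is the number of length-`n` blocks, counted from `c`, by which `w` moves `x`. It sums to
  -- zero over a window; without a rightward crossing it is never positive, yet it is negative at
  -- `z`.
  set g : ℤ → ℤ := fun x => (w.1 x - c) / n - (x - c) / n with hg
  have hdiv : ∀ x k : ℤ, (x + k * n - c) / n = (x - c) / n + k := fun x k => by
    rw [show x + k * n - c = (x - c) + k * n by ring, Int.add_mul_ediv_right _ _ hn'.ne']
  have hper : ∀ x k : ℤ, g (x + k * n) = g x := fun x k => by
    simp only [hg, apply_add_mul, hdiv]; ring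
  have hle : ∀ x, g x ≤ 0 := fun x => by
    -- Translate `x` into the block just below `c`.
    have h1 : x + (-((x - c) / n) - 1) * n < c := by
      have := Int.emod_add_mul_ediv (x - c) n
      have := Int.emod_lt_of_pos (x - c) hn'
      linarith
    have h2 := hno _ h1
    rw [apply_add_mul] at h2
    have h3 : (w.1 x + (-((x - c) / n) - 1) * n - c) / n < 0 := Int.ediv_neg_of_neg_of_pos
      (by linarith) hn'
    rw [hdiv] at h3
    simp only [hg]
    linarith
  have hsum : ∑ x ∈ Finset.Icc (1 : ℤ) n, g x = 0 := by
    have h1 := sum_comp_eq w.2.1 (fun v => (v - c) % n)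
      (fun v => by rw [show v + n - c = (v - c) + n by ring, Int.add_emod_right])
    simp only [Int.emod_def, Finset.sum_sub_distrib, ← Finset.mul_sum, w.2.2] at h1
    have h2 : (n : ℤ) * ∑ x ∈ Finset.Icc (1 : ℤ) n, g x = 0 := by
      simp only [hg, Finset.sum_sub_distrib]
      linarith
    exact (mul_eq_zero.1 h2).resolve_left hn'.ne'
  obtain ⟨k, hk⟩ := exists_mem_window hn z
  have hgz := (Finset.sum_eq_zero_iff_of_nonpos fun x _ => hle x).1 hsum _ hk
  rw [hper] at hgz
  have h1 : 0 ≤ (z - c) / (n : ℤ) := Int.ediv_nonneg (by linarith) hn'.le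
  have h2 : (w.1 z - c) / (n : ℤ) < 0 := Int.ediv_neg_of_neg_of_pos (by linarith) hn'
  simp only [hg] at hgz
  linarith

theorem exists_crossing_left (hn : 1 ≤ n) (w : affineSymmetricGroup n) {c z : ℤ} (hz : z < c)
    (hwz : c ≤ w.1 z) : ∃ y, c ≤ y ∧ w.1 y < c := by
  obtain ⟨y, hy, hy'⟩ := exists_crossing_right hn w⁻¹ (c := c) (z := w.1 z) hwz
    (by change w.1⁻¹ (w.1 z) < c; rwa [inv_apply_apply])
  exact ⟨w.1⁻¹ y, hy', by rwa [apply_inv_apply]⟩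

/-- If either bound fails, the inverted pair makes a crossing in one direction, and the compensating
crossing in the other direction completes a 321 pattern. -/
theorem Avoids.descent_bounds (hn : 1 ≤ n) {w : affineSymmetricGroup n} (h : Avoids w) {b : ℤ}
    (hb : IsDescent w b) : w.1⁻¹ (b + 1) ≤ b ∧ b + 1 ≤ w.1⁻¹ b := by
  unfold IsDescent at hb
  have hx := apply_inv_apply w (b + 1)
  have hy := apply_inv_apply w b
  set x := w.1⁻¹ (b + 1)
  set y := w.1⁻¹ b
  constructor
  · by_contra hlt
    obtain ⟨z, hz, hz'⟩ := exists_crossing_right hn w (c := x) (z := y) hb.le (by omega)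
    have : w.1 z ≠ w.1 x := fun e => hz.ne (w.1.injective e)
    exact h z x y hz hb (by omega) (by omega)
  · by_contra hlt
    obtain ⟨z, hz, hz'⟩ := exists_crossing_left hn w (c := y + 1) (z := x) (by omega) (by omega)
    have : w.1 z ≠ w.1 y := fun e => by
      have := w.1.injective e
      omega
    exact h x y z hb (by omega) (by omega) (by omega)

/-- By `Avoids.descent_bounds`, removing a descent lowers one positive displacement by one, while
the other displacement stays nonpositive. -/
theorem Avoids.length_eq (hn : 2 ≤ n) {w : affineSymmetricGroup n} (h : Avoids w) :
    (length w : ℤ) = displacementSum (fun d => max d 0) w := by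
  induction hN : length w using Nat.strong_induction_on generalizing w with
  | _ N ih =>
    obtain ⟨l, hl⟩ := exists_isReducedWord hn w
    match l with
    | [] =>
      have hw : w = 1 := by rw [← hl.1, wordProd_nil]
      rw [← hN, ← hl.2, hw]
      simp [displacementSum]
    | a :: t =>
      obtain ⟨b, rfl⟩ := ZMod.intCast_surjective a
      have hb := hl.isDescent hn
      have h1 := length_simple_mul hn hb
      have h2 := ih _ (by omega) (h.simple_mul hn hb) rfl
      rw [displacementSum_simple_mul hn] at h2
      obtain ⟨h3, h4⟩ := h.descent_bounds (by omega) hb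
      rw [max_eq_right (by omega), max_eq_right (by omega), max_eq_left (by omega),
        max_eq_left (by omega)] at h2
      omega

/-! ### Increasing enumerations of unions of residue classes -/

/-- `e` enumerates increasingly the integers whose residue lies in `A`, and `k` consecutive values
of `e` span one period. -/
structure IsEnumeration (A : Finset (ZMod n)) (k : ℕ) (e : ℤ → ℤ) : Prop where
  strictMono : StrictMono e
  mem_iff : ∀ x : ℤ, (x : ZMod n) ∈ A ↔ ∃ j, e j = x
  map_add : ∀ j, e (j + k) = e j + n

namespace IsEnumeration

variable {A : Finset (ZMod n)} {k : ℕ} {e : ℤ → ℤ}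

theorem mem (h : IsEnumeration A k e) (j : ℤ) : (e j : ZMod n) ∈ A := (h.mem_iff _).2 ⟨j, rfl⟩

theorem map_add_mul (h : IsEnumeration A k e) (j m : ℤ) : e (j + m * k) = e j + m * n := by
  induction m using Int.induction_on with
  | zero => simp
  | succ m ih =>
    rw [show j + ((m : ℤ) + 1) * k = (j + m * k) + k by ring, h.map_add, ih]; ring
  | pred m ih =>
    have h' := h.map_add (j + (-(m : ℤ) - 1) * k)
    rw [show j + (-(m : ℤ) - 1) * k + k = j + -(m : ℤ) * k by ring, ih] at h'
    linarith

theorem pos (h : IsEnumeration A k e) (hn : 1 ≤ n) : 0 < k := by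
  by_contra hk
  have := h.map_add 0
  rw [show k = 0 by omega] at this
  simp at this
  omega

theorem injOn (h : IsEnumeration A k e) :
    Set.InjOn (fun j : ℕ => (e j : ZMod n)) (Finset.range k) := by
  intro i hi j hj hij
  rw [Finset.coe_range, Set.mem_Iio] at hi hj
  obtain ⟨m, hm⟩ := (intCast_eq_iff_exists _ _).1 hij
  rw [← h.map_add_mul] at hm
  have h1 : (i : ℤ) = j + m * k := h.strictMono.injective hm
  have hk : (0 : ℤ) < k := by omega
  have h2 : m < 1 := by
    by_contra hlt
    have : (1 : ℤ) * k ≤ m * k := mul_le_mul_of_nonneg_right (by omega) hk.le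
    omega
  have h3 : -1 < m := by
    by_contra hlt
    have : m * k ≤ (-1 : ℤ) * k := mul_le_mul_of_nonneg_right (by omega) hk.le
    omega
  have h4 : m = 0 := by omega
  rw [h4] at h1
  omega

theorem image_range (h : IsEnumeration A k e) (hn : 1 ≤ n) :
    (Finset.range k).image (fun j : ℕ => (e j : ZMod n)) = A := by
  have hk := h.pos hn
  ext a
  rw [Finset.mem_image]
  constructor
  · rintro ⟨j, -, rfl⟩
    exact h.mem j
  · intro ha
    obtain ⟨x, rfl⟩ := ZMod.intCast_surjective a
    obtain ⟨j, rfl⟩ := (h.mem_iff x).1 ha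
    have h1 := Int.emod_nonneg j (b := k) (by omega)
    have h2 := Int.emod_lt_of_pos j (b := k) (by omega)
    refine ⟨(j % k).toNat, by rw [Finset.mem_range]; omega, ?_⟩
    rw [Int.toNat_of_nonneg h1]
    have h3 := h.map_add_mul (j % k) (j / k)
    rw [mul_comm, Int.emod_add_mul_ediv] at h3
    rw [h3]
    simp

theorem card_eq (h : IsEnumeration A k e) (hn : 1 ≤ n) : A.card = k := by
  conv_lhs => rw [← h.image_range hn]
  rw [Finset.card_image_of_injOn h.injOn, Finset.card_range]

theorem sum_eq {M : Type*} [AddCommMonoid M] (h : IsEnumeration A k e) (hn : 1 ≤ n)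
    (g : ZMod n → M) : ∑ j ∈ Finset.range k, g (e j) = ∑ a ∈ A, g a := by
  conv_rhs => rw [← h.image_range hn]
  rw [Finset.sum_image h.injOn]

theorem exists_shift (h : IsEnumeration A k e) {k' : ℕ} {e' : ℤ → ℤ}
    (h' : IsEnumeration A k' e') : ∃ s, ∀ j, e' j = e (j + s) := by
  choose σ hσ using fun j => (h.mem_iff _).1 (h'.mem j)
  have hmono : StrictMono σ := fun i j hij => by
    rw [← h.strictMono.lt_iff_lt, hσ, hσ]
    exact h'.strictMono hij
  have hsurj : Function.Surjective σ := fun i => by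
    obtain ⟨j, hj⟩ := (h'.mem_iff _).1 (h.mem i)
    exact ⟨j, h.strictMono.injective (by rw [hσ, hj])⟩
  exact ⟨σ 0, fun j => by
    rw [← eq_add_of_strictMono_of_surjective hmono hsurj, hσ]⟩

/-- Each unit shift trades the term `e s` for `e (s + k) = e s + n`. -/
theorem sum_shift (h : IsEnumeration A k e) (s : ℤ) :
    ∑ j ∈ Finset.range k, e (j + s) = ∑ j ∈ Finset.range k, e j + s * n := by
  have step : ∀ s : ℤ, ∑ j ∈ Finset.range k, e (j + (s + 1)) =
      ∑ j ∈ Finset.range k, e (j + s) + n := fun s => by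
    have h1 := Finset.sum_range_succ (fun j : ℕ => e (j + s)) k
    have h2 := Finset.sum_range_succ' (fun j : ℕ => e (j + s)) k
    have h3 := h.map_add s
    rw [add_comm s] at h3
    rw [h1, h3] at h2
    push_cast at h2
    rw [zero_add] at h2
    have h4 : ∑ j ∈ Finset.range k, e (j + (s + 1)) =
        ∑ j ∈ Finset.range k, e ((j : ℤ) + 1 + s) :=
      Finset.sum_congr rfl fun j _ => by rw [show (j : ℤ) + (s + 1) = j + 1 + s by ring]
    rw [h4]
    linarith
  induction s using Int.induction_on with
  | zero => simp
  | succ m ih => rw [step, ih]; ring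
  | pred m ih =>
    have h5 := step (-(m : ℤ) - 1)
    rw [sub_add_cancel, ih] at h5
    linarith

end IsEnumeration

theorem isEnumeration_univ [NeZero n] :
    IsEnumeration (Finset.univ : Finset (ZMod n)) n fun j => j + 1 where
  strictMono := fun i j h => by simpa using h
  mem_iff := fun x => by simpa using ⟨x - 1, by ring⟩
  map_add := fun j => by ring

theorem sum_window_eq_sum_range (f : ℤ → ℤ) :
    ∑ x ∈ Finset.Icc (1 : ℤ) n, f x = ∑ j ∈ Finset.range n, f (j + 1) := by
  symm
  refine Finset.sum_nbij' (fun j : ℕ => (j : ℤ) + 1) (fun x => (x - 1).toNat) ?_ ?_ ?_ ?_ ?_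
  · intro j hj
    rw [Finset.mem_range] at hj
    rw [Finset.mem_Icc]
    omega
  · intro x hx
    rw [Finset.mem_Icc] at hx
    rw [Finset.mem_range]
    omega
  · intro j hj
    omega
  · intro x hx
    rw [Finset.mem_Icc] at hx
    omega
  · intro j _
    rfl

theorem sum_window_eq_add [NeZero n] {A : Finset (ZMod n)} {k k' : ℕ} {e e' : ℤ → ℤ}
    (h : IsEnumeration A k e) (h' : IsEnumeration Aᶜ k' e') {f : ℤ → ℤ}
    (hf : ∀ x, f (x + n) = f x) :
    ∑ x ∈ Finset.Icc (1 : ℤ) n, f x =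
      ∑ j ∈ Finset.range k, f (e j) + ∑ j ∈ Finset.range k', f (e' j) := by
  have hn : 1 ≤ n := NeZero.one_le
  have hfk : ∀ x m : ℤ, f (x + m * n) = f x := fun x m => by
    induction m using Int.induction_on with
    | zero => simp
    | succ m ih => rw [show x + ((m : ℤ) + 1) * n = (x + m * n) + n by ring, hf, ih]
    | pred m ih => rw [← hf, show x + (-(m : ℤ) - 1) * n + n = x + -(m : ℤ) * n by ring, ih]
  set g : ZMod n → ℤ := fun a => f a.val with hg
  have hgf : ∀ x : ℤ, f x = g x := fun x => by
    obtain ⟨m, hm⟩ := (intCast_eq_iff_exists (n := n) x (((x : ZMod n).val : ℕ) : ℤ)).1 (by simp)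
    conv_lhs => rw [hm, hfk]
  rw [sum_window_eq_sum_range]
  simp only [hgf]
  rw [isEnumeration_univ.sum_eq hn g, h.sum_eq hn g, h'.sum_eq hn g, Finset.sum_add_sum_compl]

/-- The integers with residue in `A` form a locally finite linear order without endpoints, hence a
copy of `ℤ`. Adding `n` becomes an order automorphism, so a translation, whose amount is `A.card` by
`IsEnumeration.card_eq`. -/
theorem exists_isEnumeration (hn : 1 ≤ n) {A : Finset (ZMod n)} (hA : A.Nonempty) :
    ∃ e, IsEnumeration A A.card e := by
  classical
  have hn' : (0 : ℤ) < n := by exact_mod_cast hn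
  obtain ⟨a, ha⟩ := hA
  obtain ⟨x₀, rfl⟩ := ZMod.intCast_surjective a
  let S := {x : ℤ // (x : ZMod n) ∈ A}
  have hadd : ∀ x : S, ((x.1 + n : ℤ) : ZMod n) ∈ A := fun x => by simpa using x.2
  have hsub : ∀ x : S, ((x.1 - n : ℤ) : ZMod n) ∈ A := fun x => by simpa using x.2
  have : Nonempty S := ⟨⟨x₀, ha⟩⟩
  have : NoMaxOrder S := ⟨fun x => ⟨⟨x.1 + n, hadd x⟩, by
    change x.1 < x.1 + n
    omega⟩⟩
  have : NoMinOrder S := ⟨fun x => ⟨⟨x.1 - n, hsub x⟩, by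
    change x.1 - n < x.1
    omega⟩⟩
  let _ : SuccOrder S := LinearLocallyFiniteOrder.succOrder S
  let _ : PredOrder S := LinearLocallyFiniteOrder.predOrder S
  let f : S ≃o ℤ := orderIsoIntOfLinearSuccPredArch
  let τ : ℤ → ℤ := fun j => f ⟨(f.symm j).1 + n, hadd _⟩
  have hτ : StrictMono τ := fun i j hij => by
    apply f.strictMono
    change (f.symm i).1 + (n : ℤ) < (f.symm j).1 + n
    have h : (f.symm i).1 < (f.symm j).1 := f.symm.strictMono hij
    omega
  have hτs : Function.Surjective τ := fun i => by
    refine ⟨f ⟨(f.symm i).1 - n, hsub _⟩, ?_⟩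
    simp only [τ, OrderIso.symm_apply_apply, sub_add_cancel, Subtype.coe_eta,
      OrderIso.apply_symm_apply]
  have htr := eq_add_of_strictMono_of_surjective hτ hτs
  have hpos : 0 < τ 0 := by
    rw [← f.symm.lt_iff_lt]
    simp only [τ, OrderIso.symm_apply_apply]
    change (f.symm 0).1 < (f.symm 0).1 + n
    omega
  have he : IsEnumeration A (τ 0).toNat fun j => (f.symm j).1 := by
    refine ⟨fun i j hij => f.symm.strictMono hij, fun x => ⟨fun hx => ⟨f ⟨x, hx⟩, by simp⟩, ?_⟩,
      fun j => ?_⟩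
    · rintro ⟨j, rfl⟩
      exact (f.symm j).2
    · rw [Int.toNat_of_nonneg hpos.le, ← htr]
      simp only [τ, OrderIso.symm_apply_apply]
  rw [he.card_eq hn]
  exact ⟨_, he⟩

/-! ### The two increasing halves of a 321-avoiding element -/

/-- As `q` moves right, some later integer lands at or below `q`; it would extend an inversion of
`p` and `q` to a 321 pattern. -/
theorem Avoids.strictMonoOn_right (hn : 1 ≤ n) {w : affineSymmetricGroup n} (h : Avoids w)
    {p q : ℤ} (hpq : p < q) (hq : q < w.1 q) : w.1 p < w.1 q := by
  by_contra hlt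
  have hne : w.1 p ≠ w.1 q := fun e => hpq.ne (w.1.injective e)
  obtain ⟨z, hz, hz'⟩ := exists_crossing_left hn w (c := q + 1) (z := q) (by omega) (by omega)
  exact h p q z hpq (by omega) (by omega) (by omega)

theorem Avoids.strictMonoOn_left (hn : 1 ≤ n) {w : affineSymmetricGroup n} (h : Avoids w)
    {p q : ℤ} (hpq : p < q) (hp : w.1 p ≤ p) : w.1 p < w.1 q := by
  by_contra hlt
  have hne : w.1 p ≠ w.1 q := fun e => hpq.ne (w.1.injective e)
  obtain ⟨z, hz, hz'⟩ := exists_crossing_right hn w (c := p) (z := q) (by omega) (by omega)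
  have hne' : w.1 z ≠ w.1 p := fun e => hz.ne (w.1.injective e)
  exact h z p q hz hpq (by omega) (by omega)

open Classical in
/-- The residues of the integers that `w` moves to the right. -/
noncomputable def movedRight [NeZero n] (w : affineSymmetricGroup n) : Finset (ZMod n) :=
  Finset.univ.filter fun a => ∃ x : ℤ, (x : ZMod n) = a ∧ x < w.1 x

open Classical in
/-- The residues of the images of the integers that `w` moves to the right. -/
noncomputable def movedRightImage [NeZero n] (w : affineSymmetricGroup n) : Finset (ZMod n) :=
  Finset.univ.filter fun a => ∃ x : ℤ, (w.1 x : ZMod n) = a ∧ x < w.1 x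

theorem mem_movedRight [NeZero n] (w : affineSymmetricGroup n) (x : ℤ) :
    (x : ZMod n) ∈ movedRight w ↔ x < w.1 x := by
  simp only [movedRight, Finset.mem_filter, Finset.mem_univ, true_and]
  constructor
  · rintro ⟨y, hy, hlt⟩
    obtain ⟨k, rfl⟩ := (intCast_eq_iff_exists _ _).1 hy
    rw [apply_add_mul] at hlt
    omega
  · exact fun h => ⟨x, rfl, h⟩

theorem apply_mem_movedRightImage [NeZero n] (w : affineSymmetricGroup n) (x : ℤ) :
    (w.1 x : ZMod n) ∈ movedRightImage w ↔ x < w.1 x := by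
  simp only [movedRightImage, Finset.mem_filter, Finset.mem_univ, true_and]
  constructor
  · rintro ⟨y, hy, hlt⟩
    obtain ⟨k, hk⟩ := (intCast_eq_iff_exists _ _).1 hy
    rw [← apply_add_mul] at hk
    rw [w.1.injective hk, apply_add_mul] at hlt
    omega
  · exact fun h => ⟨x, rfl, h⟩

theorem IsEnumeration.comp_movedRight [NeZero n] {w : affineSymmetricGroup n} (hw : Avoids w)
    {k : ℕ} {e : ℤ → ℤ} (h : IsEnumeration (movedRight w) k e) :
    IsEnumeration (movedRightImage w) k fun j => w.1 (e j) where
  strictMono := fun i j hij => hw.strictMonoOn_right NeZero.one_le (h.strictMono hij)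
    ((mem_movedRight w _).1 (h.mem j))
  mem_iff := fun x => by
    rw [← apply_inv_apply w x, apply_mem_movedRightImage, ← mem_movedRight, h.mem_iff]
    exact exists_congr fun j => w.1.injective.eq_iff.symm
  map_add := fun j => by rw [h.map_add, w.2.1]

theorem IsEnumeration.comp_compl_movedRight [NeZero n] {w : affineSymmetricGroup n}
    (hw : Avoids w) {k : ℕ} {e : ℤ → ℤ} (h : IsEnumeration (movedRight w)ᶜ k e) :
    IsEnumeration (movedRightImage w)ᶜ k fun j => w.1 (e j) where
  strictMono := fun i j hij => hw.strictMonoOn_left NeZero.one_le (h.strictMono hij)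
    (not_lt.1 (by
      rw [← mem_movedRight]
      exact Finset.mem_compl.1 (h.mem i)))
  mem_iff := fun x => by
    rw [← apply_inv_apply w x, Finset.mem_compl, apply_mem_movedRightImage, ← mem_movedRight,
      ← Finset.mem_compl, h.mem_iff]
    exact exists_congr fun j => w.1.injective.eq_iff.symm
  map_add := fun j => by rw [h.map_add, w.2.1]

variable [NeZero n]

theorem displacementSum_max_eq {w : affineSymmetricGroup n} {A : Finset (ZMod n)} {k k' : ℕ}
    {e e' : ℤ → ℤ} (h : IsEnumeration A k e) (h' : IsEnumeration Aᶜ k' e')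
    (hr : ∀ j, e j < w.1 (e j)) (hl : ∀ j, w.1 (e' j) ≤ e' j) :
    displacementSum (fun d => max d 0) w = ∑ j ∈ Finset.range k, (w.1 (e j) - e j) := by
  rw [displacementSum, sum_window_eq_add h h' (f := fun x => max (w.1 x - x) 0)
    (fun x => by simp only [w.2.1, add_sub_add_right_eq_sub])]
  simp only [max_eq_left (sub_nonneg.2 (hr _).le), max_eq_right (sub_nonpos.2 (hl _)),
    Finset.sum_const_zero, add_zero]

theorem Avoids.length_eq_sum (hn : 2 ≤ n) {w : affineSymmetricGroup n} (hw : Avoids w)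
    {k k' : ℕ} {e e' : ℤ → ℤ} (h : IsEnumeration (movedRight w) k e)
    (h' : IsEnumeration (movedRight w)ᶜ k' e') :
    (length w : ℤ) = ∑ j ∈ Finset.range k, (w.1 (e j) - e j) := by
  rw [hw.length_eq hn, displacementSum_max_eq h h' (fun j => (mem_movedRight w _).1 (h.mem j))
    fun j => not_lt.1 (by
      rw [← mem_movedRight]
      exact Finset.mem_compl.1 (h'.mem j))]

theorem Avoids.movedRight_nonempty (hn : 2 ≤ n) {w : affineSymmetricGroup n} (hw : Avoids w)
    (hlen : length w ≠ 0) : (movedRight w).Nonempty := by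
  by_contra hne
  rw [Finset.not_nonempty_iff_eq_empty] at hne
  have h1 := hw.length_eq hn
  rw [displacementSum, Finset.sum_eq_zero] at h1
  · omega
  · intro x _
    have := mem_movedRight w x
    rw [hne] at this
    simp only [Finset.notMem_empty, false_iff] at this
    omega

theorem movedRight_ne_univ (w : affineSymmetricGroup n) : movedRight w ≠ Finset.univ := by
  intro hu
  have h1 : 0 < ∑ x ∈ Finset.Icc (1 : ℤ) n, (w.1 x - x) := by
    apply Finset.sum_pos
    · intro x _
      have := mem_movedRight w x
      rw [hu] at this
      simp only [Finset.mem_univ, true_iff] at this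
      omega
    · rw [Finset.nonempty_Icc]
      exact_mod_cast (NeZero.one_le : 1 ≤ n)
  rw [sum_window_apply_sub] at h1
  exact lt_irrefl _ h1

theorem compl_nonempty {α : Type*} [Fintype α] [DecidableEq α] {A : Finset α}
    (h : A ≠ Finset.univ) : Aᶜ.Nonempty := by
  rw [Finset.nonempty_iff_ne_empty]
  exact fun e => h ((Finset.compl_eq_empty_iff A).1 e)

/-! ### From fully commutative elements to pairs of residue sets -/

/-- Pairs of equinumerous sets of residues, neither empty nor everything, with prescribed
difference of sums. -/
def residuePairs (n : ℕ) [NeZero n] (r : ZMod n) :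
    Finset (Finset (ZMod n) × Finset (ZMod n)) :=
  Finset.univ.filter fun s => s.1.card = s.2.card ∧ s.1 ≠ ∅ ∧ s.1 ≠ Finset.univ ∧
    ∑ b ∈ s.2, b - ∑ a ∈ s.1, a = r

theorem mapsTo_residuePairs (hn : 2 ≤ n) {i : ℕ} (hi : i ≠ 0) :
    Set.MapsTo (fun w => (movedRight w, movedRightImage w)) (fcOfLength n i)
      (residuePairs n i) := by
  rintro w ⟨hfc, hlen⟩
  have hn1 : 1 ≤ n := by omega
  have hw := (isFullyCommutative_iff_avoids hn w).1 hfc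
  have hne := hw.movedRight_nonempty hn (by rw [hlen]; exact hi)
  obtain ⟨e, he⟩ := exists_isEnumeration hn1 hne
  obtain ⟨e', he'⟩ := exists_isEnumeration hn1 (compl_nonempty (movedRight_ne_univ w))
  have hB := he.comp_movedRight hw
  rw [Finset.mem_coe, residuePairs, Finset.mem_filter]
  refine ⟨Finset.mem_univ _, (hB.card_eq hn1).symm, hne.ne_empty, movedRight_ne_univ w, ?_⟩
  have h1 := hw.length_eq_sum hn he he'
  have h2 := congrArg (Int.cast : ℤ → ZMod n) h1
  push_cast at h2
  rw [hlen, Finset.sum_sub_distrib] at h2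
  rw [h2]
  change _ = ∑ j ∈ Finset.range _, id ((w.1 (e j) : ℤ) : ZMod n) -
    ∑ j ∈ Finset.range _, id ((e j : ℤ) : ZMod n)
  rw [hB.sum_eq hn1 id, he.sum_eq hn1 id]
  rfl

/-- Two elements with the same data differ by a shift `s` on the integers moved right and `s'` on
the others. Equal lengths give `s = 0`, and then the vanishing sum of displacements gives `s' = 0`.
-/
theorem injOn_residuePairs (hn : 2 ≤ n) {i : ℕ} (hi : i ≠ 0) :
    Set.InjOn (fun w => (movedRight w, movedRightImage w)) (fcOfLength n i) := by
  rintro w ⟨hfc, hlen⟩ v ⟨hfc', hlen'⟩ heq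
  have hn1 : 1 ≤ n := by omega
  have hn0 : (n : ℤ) ≠ 0 := by omega
  simp only [Prod.mk.injEq] at heq
  have hw := (isFullyCommutative_iff_avoids hn w).1 hfc
  have hv := (isFullyCommutative_iff_avoids hn v).1 hfc'
  have hne := hw.movedRight_nonempty hn (by rw [hlen]; exact hi)
  obtain ⟨e, he⟩ := exists_isEnumeration hn1 hne
  obtain ⟨e', he'⟩ := exists_isEnumeration hn1 (compl_nonempty (movedRight_ne_univ w))
  generalize (movedRight w).card = k at he
  generalize (movedRight w)ᶜ.card = k' at he'
  have hev := heq.1 ▸ he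
  have hev' := heq.1 ▸ he'
  have hB := he.comp_movedRight hw
  have hB' := he'.comp_compl_movedRight hw
  have hBv := hev.comp_movedRight hv
  have hBv' := hev'.comp_compl_movedRight hv
  rw [← heq.2] at hBv hBv'
  obtain ⟨s, hs⟩ := hB.exists_shift hBv
  obtain ⟨s', hs'⟩ := hB'.exists_shift hBv'
  have h1 := hw.length_eq_sum hn he he'
  have h2 := hv.length_eq_sum hn hev hev'
  simp only [hs, Finset.sum_sub_distrib] at h2
  rw [hB.sum_shift s] at h2
  rw [Finset.sum_sub_distrib, hlen] at h1
  rw [hlen'] at h2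
  have hs0 : s = 0 := by
    have : s * (n : ℤ) = 0 := by linarith
    exact (mul_eq_zero.1 this).resolve_right hn0
  have h3 := sum_window_apply_sub w
  have h4 := sum_window_apply_sub v
  rw [sum_window_eq_add he he' fun x => by simp only [w.2.1, add_sub_add_right_eq_sub]] at h3
  rw [sum_window_eq_add he he' fun x => by simp only [v.2.1, add_sub_add_right_eq_sub]] at h4
  simp only [hs, hs', Finset.sum_sub_distrib] at h3 h4
  rw [hB.sum_shift s, hB'.sum_shift s', hs0] at h4
  have hs0' : s' = 0 := by
    have : s' * (n : ℤ) = 0 := by linarith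
    exact (mul_eq_zero.1 this).resolve_right hn0
  apply Subtype.ext
  apply Equiv.ext
  intro x
  by_cases hx : (x : ZMod n) ∈ movedRight w
  · obtain ⟨j, rfl⟩ := (he.mem_iff x).1 hx
    rw [hs, hs0, add_zero]
  · obtain ⟨j, rfl⟩ := (he'.mem_iff x).1 (Finset.mem_compl.2 hx)
    rw [hs', hs0', add_zero]

/-! ### Realising every pair in large length -/

/-- A large shift of one enumeration dominates another one with the same number of residues. -/
theorem exists_shift_dominates {A B : Finset (ZMod n)} {k : ℕ} {e f : ℤ → ℤ}
    (he : IsEnumeration A k e) (hf : IsEnumeration B k f) :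
    ∃ H : ℤ, ∀ s, H ≤ s → ∀ j, e j < f (j + s) := by
  have hn : 1 ≤ n := NeZero.one_le
  have hk := he.pos hn
  -- `e j - f j` is `k`-periodic in `j`, so `M` bounds it everywhere; a shift by `(M + 1) * k`
  -- raises `f` by `(M + 1) * n > M`.
  set M : ℤ := ∑ j ∈ Finset.range k, |e j - f j| with hM
  have hM0 : 0 ≤ M := Finset.sum_nonneg fun _ _ => abs_nonneg _
  have hbound : ∀ j, e j - f j ≤ M := fun j => by
    have h1 := Int.emod_nonneg j (b := k) (by omega)
    have h2 := Int.emod_lt_of_pos j (b := k) (by omega)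
    have h3 := he.map_add_mul (j % k) (j / k)
    have h4 := hf.map_add_mul (j % k) (j / k)
    rw [mul_comm, Int.emod_add_mul_ediv] at h3 h4
    have h5 : e j - f j = e (j % k) - f (j % k) := by linarith
    have h6 := Finset.single_le_sum (f := fun j : ℕ => |e j - f j|) (s := Finset.range k)
      (fun _ _ => abs_nonneg _) (a := (j % k).toNat) (by rw [Finset.mem_range]; omega)
    simp only [Int.toNat_of_nonneg h1] at h6
    rw [h5]
    exact (le_abs_self _).trans h6
  refine ⟨(M + 1) * k, fun s hs j => ?_⟩
  have h1 := hbound j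
  have h2 := hf.map_add_mul j (M + 1)
  have h3 : f (j + (M + 1) * k) ≤ f (j + s) := hf.strictMono.monotone (by omega)
  have h4 : (M + 1) * 1 ≤ (M + 1) * (n : ℤ) :=
    mul_le_mul_of_nonneg_left (by exact_mod_cast hn) (by omega)
  linarith

/-- Two enumerations of complementary sets can be matched with two others by a bijection. -/
theorem exists_perm_of_isEnumeration {A B : Finset (ZMod n)} {k k' l l' : ℕ}
    {e e' f f' : ℤ → ℤ} (he : IsEnumeration A k e) (he' : IsEnumeration Aᶜ k' e')
    (hf : IsEnumeration B l f) (hf' : IsEnumeration Bᶜ l' f') (s s' : ℤ) :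
    ∃ w : Equiv.Perm ℤ, (∀ j, w (e j) = f (j + s)) ∧ ∀ j, w (e' j) = f' (j + s') := by
  have key : ∀ {A : Finset (ZMod n)} {k k' : ℕ} {e e' : ℤ → ℤ}, IsEnumeration A k e →
      IsEnumeration Aᶜ k' e' → Function.Bijective (Sum.elim e e') := by
    intro A k k' e e' h h'
    refine ⟨Function.Injective.sumElim h.strictMono.injective h'.strictMono.injective ?_, ?_⟩
    · intro i j hij
      have := h'.mem j
      rw [← hij] at this
      exact Finset.mem_compl.1 this (h.mem i)
    · intro x
      by_cases hx : (x : ZMod n) ∈ A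
      · obtain ⟨j, hj⟩ := (h.mem_iff x).1 hx
        exact ⟨Sum.inl j, hj⟩
      · obtain ⟨j, hj⟩ := (h'.mem_iff x).1 (Finset.mem_compl.2 hx)
        exact ⟨Sum.inr j, hj⟩
  let E := Equiv.ofBijective _ (key he he')
  let F := Equiv.ofBijective _ (key hf hf')
  refine ⟨E.symm.trans (((Equiv.addRight s).sumCongr (Equiv.addRight s')).trans F),
    fun j => ?_, fun j => ?_⟩
  · have : E.symm (e j) = Sum.inl j := E.symm_apply_apply (Sum.inl j)
    simp [this, F]
  · have : E.symm (e' j) = Sum.inr j := E.symm_apply_apply (Sum.inr j)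
    simp [this, F]

theorem exists_mem_fcOfLength (hn : 2 ≤ n) {A B : Finset (ZMod n)} (hcard : A.card = B.card)
    (hA : A ≠ ∅) (hA' : A ≠ Finset.univ) :
    ∃ N : ℕ, ∀ i : ℕ, N ≤ i → ∑ b ∈ B, b - ∑ a ∈ A, a = (i : ZMod n) →
      ∃ w ∈ fcOfLength n i, movedRight w = A ∧ movedRightImage w = B := by
  have hn1 : 1 ≤ n := by omega
  have hn0 : (0 : ℤ) < n := by omega
  have hcard' : Aᶜ.card = Bᶜ.card := by rw [Finset.card_compl, Finset.card_compl, hcard]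
  have hAne := Finset.nonempty_iff_ne_empty.2 hA
  have hAne' := compl_nonempty hA'
  obtain ⟨e, he⟩ := exists_isEnumeration hn1 hAne
  obtain ⟨e', he'⟩ := exists_isEnumeration hn1 hAne'
  obtain ⟨f, hf⟩ := exists_isEnumeration (A := B) hn1
    (Finset.card_pos.1 (hcard ▸ Finset.card_pos.2 hAne))
  obtain ⟨f', hf'⟩ := exists_isEnumeration (A := Bᶜ) hn1
    (Finset.card_pos.1 (hcard' ▸ Finset.card_pos.2 hAne'))
  rw [← hcard] at hf
  rw [← hcard'] at hf'
  obtain ⟨H, hH⟩ := exists_shift_dominates he hf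
  obtain ⟨H', hH'⟩ := exists_shift_dominates hf' he'
  set k := A.card
  set k' := Aᶜ.card
  set SA := ∑ j ∈ Finset.range k, e j with hSA
  set SA' := ∑ j ∈ Finset.range k', e' j with hSA'
  set SB := ∑ j ∈ Finset.range k, f j with hSB
  set SB' := ∑ j ∈ Finset.range k', f' j with hSB'
  have cast_sum : ∀ {A : Finset (ZMod n)} {k : ℕ} {e : ℤ → ℤ}, IsEnumeration A k e →
      ((∑ j ∈ Finset.range k, e j : ℤ) : ZMod n) = ∑ a ∈ A, a := fun h => by
    push_cast
    exact h.sum_eq hn1 id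
  -- Both `SA + SA'` and `SB + SB'` reduce to the sum of all residues.
  obtain ⟨c, hc⟩ : (n : ℤ) ∣ SB + SB' - SA - SA' := by
    rw [← ZMod.intCast_zmod_eq_zero_iff_dvd]
    push_cast [hSA, hSA', hSB, hSB']
    have h1 := cast_sum he
    have h2 := cast_sum he'
    have h3 := cast_sum hf
    have h4 := cast_sum hf'
    push_cast at h1 h2 h3 h4
    rw [h1, h2, h3, h4, Finset.sum_add_sum_compl, sub_sub, Finset.sum_add_sum_compl, sub_self]
  -- The length will be `SB - SA + s * n`, so this threshold forces `s ≥ H` and `s + c ≥ H'`.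
  refine ⟨(SB - SA + (|H| + |H'| + |c|) * n).toNat, fun i hi hsum => ?_⟩
  obtain ⟨s, hs⟩ : (n : ℤ) ∣ i - (SB - SA) := by
    rw [← ZMod.intCast_zmod_eq_zero_iff_dvd]
    have h1 := cast_sum he
    have h3 := cast_sum hf
    rw [Int.cast_sub, Int.cast_sub, h1, h3, hsum]
    simp
  have hsbig : |H| + |H'| + |c| ≤ s := by
    have h1 : (|H| + |H'| + |c|) * (n : ℤ) ≤ s * n := by
      have := Int.toNat_le.1 hi
      linarith
    exact le_of_mul_le_mul_right h1 hn0
  have hHs : H ≤ s := by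
    have := le_abs_self H
    have := abs_nonneg H'
    have := abs_nonneg c
    omega
  have hHs' : H' ≤ s + c := by
    have := le_abs_self H'
    have := abs_nonneg H
    have := neg_abs_le c
    omega
  -- The shift `-(s + c)` on the complement is the one that makes the displacements sum to zero.
  obtain ⟨w, hw, hw'⟩ := exists_perm_of_isEnumeration he he' hf hf' s (-(s + c))
  have hcases : ∀ x : ℤ, (∃ j, e j = x) ∨ ∃ j, e' j = x := fun x => by
    by_cases hx : (x : ZMod n) ∈ A
    · exact Or.inl ((he.mem_iff x).1 hx)
    · exact Or.inr ((he'.mem_iff x).1 (Finset.mem_compl.2 hx))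
  have hper : ∀ x, w (x + n) = w x + n := fun x => by
    rcases hcases x with ⟨j, rfl⟩ | ⟨j, rfl⟩
    · rw [← he.map_add, hw, hw, ← hf.map_add]
      congr 1; ring
    · rw [← he'.map_add, hw', hw', ← hf'.map_add]
      congr 1; ring
  have hsumw : ∑ x ∈ Finset.Icc (1 : ℤ) n, w x = ∑ x ∈ Finset.Icc (1 : ℤ) n, x := by
    rw [← sub_eq_zero, ← Finset.sum_sub_distrib,
      sum_window_eq_add he he' fun x => by simp only [hper, add_sub_add_right_eq_sub]]
    simp only [hw, hw', Finset.sum_sub_distrib]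
    rw [hf.sum_shift, hf'.sum_shift]
    linarith
  have hr : ∀ j, e j < w (e j) := fun j => by
    rw [hw]
    exact hH s hHs j
  have hl : ∀ j, w (e' j) ≤ e' j := fun j => by
    rw [hw']
    have := hH' (s + c) hHs' (j + -(s + c))
    rw [neg_add_cancel_right] at this
    exact this.le
  let u : affineSymmetricGroup n := ⟨w, hper, hsumw⟩
  have hmr : movedRight u = A := by
    ext a
    obtain ⟨x, rfl⟩ := ZMod.intCast_surjective a
    rw [mem_movedRight]
    rcases hcases x with ⟨j, rfl⟩ | ⟨j, rfl⟩
    · exact iff_of_true (hr j) (he.mem j)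
    · exact iff_of_false (not_lt.2 (hl j)) (Finset.mem_compl.1 (he'.mem j))
  have hmi : movedRightImage u = B := by
    ext a
    obtain ⟨y, rfl⟩ := ZMod.intCast_surjective a
    obtain ⟨x, rfl⟩ := w.surjective y
    refine (apply_mem_movedRightImage u x).trans ?_
    rcases hcases x with ⟨j, rfl⟩ | ⟨j, rfl⟩
    · exact iff_of_true (hr j) (by rw [hw]; exact hf.mem _)
    · exact iff_of_false (not_lt.2 (hl j)) (by rw [hw']; exact Finset.mem_compl.1 (hf'.mem _))
  -- `u` is increasing on two sets covering `ℤ`, and two of any three integers lie in the same one.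
  have hav : Avoids u := by
    have mono : ∀ i j, e i < e j → w (e i) < w (e j) := fun i j hij => by
      rw [hw, hw]
      exact hf.strictMono (by have := he.strictMono.lt_iff_lt.1 hij; omega)
    have mono' : ∀ i j, e' i < e' j → w (e' i) < w (e' j) := fun i j hij => by
      rw [hw', hw']
      exact hf'.strictMono (by have := he'.strictMono.lt_iff_lt.1 hij; omega)
    intro x y z hxy hyz h1 h2
    change w y < w x at h1
    change w z < w y at h2
    rcases hcases x with ⟨a, rfl⟩ | ⟨a, rfl⟩ <;> rcases hcases y with ⟨b, rfl⟩ | ⟨b, rfl⟩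
    · exact lt_asymm h1 (mono _ _ hxy)
    · rcases hcases z with ⟨c, rfl⟩ | ⟨c, rfl⟩
      · exact lt_asymm (h2.trans h1) (mono _ _ (hxy.trans hyz))
      · exact lt_asymm h2 (mono' _ _ hyz)
    · rcases hcases z with ⟨c, rfl⟩ | ⟨c, rfl⟩
      · exact lt_asymm h2 (mono _ _ hyz)
      · exact lt_asymm (h2.trans h1) (mono' _ _ (hxy.trans hyz))
    · exact lt_asymm h1 (mono' _ _ hxy)
  refine ⟨u, ⟨hav.isFullyCommutative hn, ?_⟩, hmr, hmi⟩
  have hlen := hav.length_eq hn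
  rw [displacementSum_max_eq he he' hr hl] at hlen
  change (length u : ℤ) = ∑ j ∈ Finset.range k, (w (e j) - e j) at hlen
  simp only [hw, Finset.sum_sub_distrib] at hlen
  rw [hf.sum_shift] at hlen
  have : (length u : ℤ) = i := by linarith
  exact_mod_cast this

theorem affineSymmetricGroup_one_eq_one (w : affineSymmetricGroup 1) : w = 1 := by
  by_contra hw
  obtain ⟨b, hb⟩ := exists_isDescent le_rfl hw
  have := inv_map_add w.2.1 b
  unfold IsDescent at hb
  push_cast at this
  omega

theorem exists_ncard_fcOfLength_eq (n : ℕ) [NeZero n] :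
    ∃ N : ℕ, ∀ i ≥ N, (fcOfLength n i).ncard = (residuePairs n i).card := by
  rcases Nat.lt_or_ge n 2 with hn | hn
  · obtain rfl : n = 1 := by have : 1 ≤ n := NeZero.one_le; omega
    refine ⟨1, fun i hi => ?_⟩
    have h1 : fcOfLength 1 i = ∅ := by
      rw [Set.eq_empty_iff_forall_notMem]
      rintro w ⟨-, hlen⟩
      rw [affineSymmetricGroup_one_eq_one w, length_one] at hlen
      omega
    have h2 : residuePairs 1 i = ∅ := by
      rw [Finset.eq_empty_iff_forall_notMem]
      intro s hs
      rw [residuePairs, Finset.mem_filter] at hs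
      obtain ⟨a, ha⟩ := Finset.nonempty_iff_ne_empty.2 hs.2.2.1
      refine hs.2.2.2.1 (Finset.eq_univ_iff_forall.2 fun b => ?_)
      have : Subsingleton (ZMod 1) := inferInstanceAs (Subsingleton (Fin 1))
      rwa [Subsingleton.elim b a]
    rw [h1, h2, Set.ncard_empty, Finset.card_empty]
  · choose! N hN using fun s : Finset (ZMod n) × Finset (ZMod n) =>
      fun h : s.1.card = s.2.card ∧ s.1 ≠ ∅ ∧ s.1 ≠ Finset.univ =>
        exists_mem_fcOfLength hn h.1 h.2.1 h.2.2
    -- The supremum serves all of the finitely many pairs; the `+ 1` excludes length zero.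
    refine ⟨Finset.univ.sup N + 1, fun i hi => ?_⟩
    have hi0 : i ≠ 0 := by omega
    have himage : (fun w => (movedRight w, movedRightImage w)) '' fcOfLength n i =
        (residuePairs n i : Set _) := by
      refine Set.Subset.antisymm (mapsTo_residuePairs hn hi0).image_subset ?_
      intro s hs
      rw [Finset.mem_coe, residuePairs, Finset.mem_filter] at hs
      obtain ⟨-, h1, h2, h3, h4⟩ := hs
      have hle : N s ≤ i := (Finset.le_sup (Finset.mem_univ s)).trans (by omega)
      obtain ⟨w, hw, hw1, hw2⟩ := hN s ⟨h1, h2, h3⟩ i hle h4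
      exact ⟨w, hw, Prod.ext hw1 hw2⟩
    rw [← (injOn_residuePairs hn hi0).ncard_image, himage, Set.ncard_coe_finset]

/-! ### Finiteness and eventual periods -/

theorem finite_fcOfLength (n : ℕ) [NeZero n] (i : ℕ) : (fcOfLength n i).Finite := by
  rcases Nat.lt_or_ge n 2 with hn | hn
  · obtain rfl : n = 1 := by have : 1 ≤ n := NeZero.one_le; omega
    exact (Set.finite_singleton 1).subset fun w _ => affineSymmetricGroup_one_eq_one w
  · refine ((List.finite_length_eq (ZMod n) i).image (wordProd n)).subset ?_
    rintro w ⟨-, hlen⟩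
    obtain ⟨l, hl⟩ := exists_isReducedWord hn w
    exact ⟨l, hl.2.trans hlen, hl.1⟩

theorem IsEventualPeriod.mod {a : ℕ → ℕ} {m k : ℕ} (hm : IsEventualPeriod a m)
    (hk : IsEventualPeriod a k) (h : 0 < k % m) : IsEventualPeriod a (k % m) := by
  obtain ⟨-, N, hN⟩ := hm
  obtain ⟨-, M, hM⟩ := hk
  have hmul : ∀ q, ∀ i ≥ N, a (i + m * q) = a i := fun q i hi => by
    induction q with
    | zero => rfl
    | succ q ih => rw [Nat.mul_succ, ← add_assoc, hN _ (by omega), ih]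
  refine ⟨h, N + M, fun i hi => ?_⟩
  rw [← hmul (k / m) (i + k % m) (by omega), add_assoc, Nat.mod_add_div, hM _ (by omega)]

/-- The least eventual period divides every other one. -/
theorem IsEventualPeriod.exists_isLeast_dvd {a : ℕ → ℕ} {k : ℕ} (hk : IsEventualPeriod a k) :
    ∃ m, m ∣ k ∧ IsLeast {j | IsEventualPeriod a j} m := by
  classical
  have hex : ∃ m, IsEventualPeriod a m := ⟨k, hk⟩
  refine ⟨Nat.find hex, ?_, Nat.find_spec hex, fun j hj => Nat.find_min' hex hj⟩
  by_contra hdvd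
  have hpos := Nat.pos_of_ne_zero fun e => hdvd (Nat.dvd_of_mod_eq_zero e)
  exact Nat.find_min hex (Nat.mod_lt _ (Nat.find_spec hex).1)
    ((Nat.find_spec hex).mod hk hpos)

theorem coeff_fcGenFun (n i : ℕ) : (fcGenFun n).coeff i = (fcOfLength n i).ncard :=
  PowerSeries.coeff_mk _ _

theorem isEventualPeriod_fcGenFun (n : ℕ) [NeZero n] :
    IsEventualPeriod (fun i => (fcGenFun n).coeff i) n := by
  obtain ⟨N, hN⟩ := exists_ncard_fcOfLength_eq n
  refine ⟨NeZero.pos n, N, fun i hi => ?_⟩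
  simp only [coeff_fcGenFun]
  rw [hN _ (by omega), hN _ hi]
  simp

/-! ### Prime `n` and the total number of pairs -/

section Prime

variable {p : ℕ} [Fact p.Prime]

theorem natCast_card_ne_zero {A : Finset (ZMod p)} (h : A ≠ ∅) (h' : A ≠ Finset.univ) :
    (A.card : ZMod p) ≠ 0 := by
  rw [Ne, ZMod.natCast_eq_zero_iff]
  intro hd
  have h1 := Nat.le_of_dvd (Finset.card_pos.2 (Finset.nonempty_iff_ne_empty.2 h)) hd
  have h2 : A.card < p := by
    have := (Finset.card_lt_iff_ne_univ A).2 h'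
    rwa [ZMod.card] at this
  omega

/-- Translating the second set by `t` adds `A.card * t` to the difference of sums, where `A` is the
first set, and `A.card` is invertible mod `p`. -/
theorem card_residuePairs_le (r r' : ZMod p) :
    (residuePairs p r).card ≤ (residuePairs p r').card := by
  refine Finset.card_le_card_of_injOn
    (fun s => (s.1, s.2.map (addRightEmbedding ((r' - r) / (s.1.card : ZMod p))))) ?_ ?_
  · intro s hs
    rw [Finset.mem_coe, residuePairs, Finset.mem_filter] at hs ⊢
    obtain ⟨-, h1, h2, h3, h4⟩ := hs
    refine ⟨Finset.mem_univ _, by simpa using h1, h2, h3, ?_⟩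
    have h5 := natCast_card_ne_zero h2 h3
    simp only [Finset.sum_map, addRightEmbedding_apply, Finset.sum_add_distrib, Finset.sum_const,
      nsmul_eq_mul, ← h1]
    rw [mul_div_cancel₀ _ h5, ← h4]
    ring
  · rintro ⟨A, B⟩ - ⟨A', B'⟩ - heq
    simp only [Prod.mk.injEq] at heq
    obtain ⟨rfl, h⟩ := heq
    rw [Finset.map_injective _ h]

theorem card_residuePairs_eq (r r' : ZMod p) :
    (residuePairs p r).card = (residuePairs p r').card :=
  le_antisymm (card_residuePairs_le _ _) (card_residuePairs_le _ _)

end Prime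

/-- Equinumerous pairs number `∑ k, (n choose k) ^ 2 = (2n choose n)`; the `2` accounts for the
empty and the full pair. -/
theorem sum_card_residuePairs (n : ℕ) [NeZero n] :
    ∑ r : ZMod n, (residuePairs n r).card + 2 = (2 * n).choose n := by
  classical
  set P : Finset (Finset (ZMod n) × Finset (ZMod n)) :=
    Finset.univ.filter fun s => s.1.card = s.2.card with hP
  set Q : Finset (Finset (ZMod n) × Finset (ZMod n)) :=
    Finset.univ.filter fun s => s.1.card = s.2.card ∧ s.1 ≠ ∅ ∧ s.1 ≠ Finset.univ with hQ
  have hQcard : ∑ r : ZMod n, (residuePairs n r).card = Q.card := by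
    rw [Finset.card_eq_sum_card_fiberwise (f := fun s => ∑ b ∈ s.2, b - ∑ a ∈ s.1, a)
      (t := Finset.univ) (fun _ _ => Finset.mem_coe.2 (Finset.mem_univ _))]
    refine Finset.sum_congr rfl fun r _ => ?_
    congr 1
    ext s
    simp only [residuePairs, hQ, Finset.mem_filter, Finset.mem_univ, true_and, and_assoc]
  have hne : (∅ : Finset (ZMod n)) ≠ Finset.univ := Finset.univ_nonempty.ne_empty.symm
  have hPQ : P = Q ∪ {(∅, ∅), (Finset.univ, Finset.univ)} := by
    ext ⟨A, B⟩
    simp only [hP, hQ, Finset.mem_union, Finset.mem_filter, Finset.mem_univ, true_and,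
      Finset.mem_insert, Finset.mem_singleton, Prod.mk.injEq]
    constructor
    · intro h
      by_cases h1 : A = ∅
      · subst h1
        exact Or.inr (Or.inl ⟨rfl, Finset.card_eq_zero.1 (by rw [← h, Finset.card_empty])⟩)
      by_cases h2 : A = Finset.univ
      · subst h2
        exact Or.inr (Or.inr ⟨rfl, (Finset.card_eq_iff_eq_univ B).1 h.symm⟩)
      · exact Or.inl ⟨h, h1, h2⟩
    · rintro (h | ⟨rfl, rfl⟩ | ⟨rfl, rfl⟩)
      · exact h.1
      · rfl
      · rfl
  have hdisj : Disjoint Q {(∅, ∅), (Finset.univ, Finset.univ)} := by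
    rw [Finset.disjoint_left]
    intro s hs hs'
    rw [hQ, Finset.mem_filter] at hs
    rw [Finset.mem_insert, Finset.mem_singleton] at hs'
    rcases hs' with rfl | rfl
    · exact hs.2.2.1 rfl
    · exact hs.2.2.2 rfl
  have hPcard : P.card = (2 * n).choose n := by
    rw [← Nat.sum_range_choose_sq, Finset.card_eq_sum_card_fiberwise (f := fun s => s.1.card)
      (t := Finset.range (n + 1))]
    · refine Finset.sum_congr rfl fun k _ => ?_
      have : P.filter (fun s => s.1.card = k) =
          Finset.powersetCard k Finset.univ ×ˢ Finset.powersetCard k Finset.univ := by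
        ext s
        simp only [hP, Finset.mem_filter, Finset.mem_univ, true_and, Finset.mem_product,
          Finset.mem_powersetCard, Finset.subset_univ]
        omega
      rw [this, Finset.card_product, Finset.card_powersetCard, Finset.card_univ, ZMod.card, sq]
    · intro s _
      have := Finset.card_le_univ s.1
      rw [ZMod.card] at this
      simp only [Finset.coe_range, Set.mem_Iio]
      omega
  rw [hQcard, ← hPcard, hPQ, Finset.card_union_of_disjoint hdisj, Finset.card_pair]
  exact fun e => hne (congrArg Prod.fst e)

theorem mul_card_residuePairs {p : ℕ} [Fact p.Prime] (r : ZMod p) :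
    p * (residuePairs p r).card + 2 = (2 * p).choose p := by
  rw [← sum_card_residuePairs, Finset.sum_congr rfl fun r' _ => card_residuePairs_eq r' r,
    Finset.sum_const, Finset.card_univ, ZMod.card, smul_eq_mul]

end AffineSymmetric

theorem corollary4p1 :
    (∀ n : ℕ, 1 ≤ n →
      (∀ i : ℕ, (AffineSymmetric.fcOfLength n i).Finite) ∧
      ∃ m : ℕ, m ∣ n ∧ IsLeast {k : ℕ | AffineSymmetric.IsEventualPeriod
        (fun i => (AffineSymmetric.fcGenFun n).coeff i) k} m) ∧
    (∀ p : ℕ, p.Prime →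
      IsLeast {k : ℕ | AffineSymmetric.IsEventualPeriod
        (fun i => (AffineSymmetric.fcGenFun p).coeff i) k} 1 ∧
      ∃ N : ℕ, ∀ i ≥ N, (((AffineSymmetric.fcOfLength p i).ncard : ℕ) : ℚ) =
        (1 / (p : ℚ)) * (((2 * p).choose p : ℚ) - 2)) := by
  refine ⟨fun n hn => ?_, fun p hp => ?_⟩
  · have : NeZero n := ⟨by omega⟩
    exact ⟨AffineSymmetric.finite_fcOfLength n,
      (AffineSymmetric.isEventualPeriod_fcGenFun n).exists_isLeast_dvd⟩
  · have : Fact p.Prime := ⟨hp⟩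
    obtain ⟨N, hN⟩ := AffineSymmetric.exists_ncard_fcOfLength_eq p
    refine ⟨⟨⟨one_pos, N, fun i hi => ?_⟩, fun k hk => hk.1⟩, N, fun i hi => ?_⟩
    · simp only [AffineSymmetric.coeff_fcGenFun]
      rw [hN _ (by omega), hN _ hi, AffineSymmetric.card_residuePairs_eq]
    · rw [hN _ hi, ← AffineSymmetric.mul_card_residuePairs (i : ZMod p)]
      have hp0 : (p : ℚ) ≠ 0 := by exact_mod_cast hp.ne_zero
      push_cast
      field_simp
      ring
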